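/- Let $n\ge 1$, let $K\subset\mathbb R^n$ be a convex body (a compact convex set with nonempty interior), and let $q>0$ be real. Write $S^{n-1}$ for the unit sphere, $\omega_n$ for the volume of the unit ball of $\mathbb R^n$, $\mathcal H^{n-1}$ for $(n-1)$-dimensional Hausdorff measure (normalized to agree with Lebesgue measure on $\mathbb R^{n-1}$), and $h_K(v)=\max_{y\in K} v\cdot y$ for the support function of $K$. For $z\in\partial K$ and $u\in S^{n-1}$ let $\rho_{K,z}(u)=\max\{\lambda\in\mathbb R: z+\lambda u\in K\}$, and let $$\widetilde V_{q-1}(K,z)=\frac1n\int_{\{u\in S^{n-1}:\ \rho_{K,z}(u)>0\}}\rho_{K,z}(u)^{q-1}\,du\in[0,\infty],$$ where $du$ is spherical Lebesgue measure, be the dual quermassintegral of index $q-1$ of $K$ with respect to $z$. Let $\partial'K$ be the set of all $z\in\partial K$ for which there is exactly one $v\in S^{n-1}$ with $z\cdot v=h_K(v)$, and let $\nu_K:\partial'K\to S^{n-1}$ be the Gauss map, which sends $z$ to this $v$. The $q$-th chord measure of $K$ is the Borel measure on $S^{n-1}$ given by $$F_q(K,\eta)=\frac{2q}{\omega_n}\int_{\nu_K^{-1}(\eta)}\widetilde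 V_{q-1}(K,z)\,d\mathcal H^{n-1}(z),\qquad \eta\subset S^{n-1}\ \text{Borel}.$$ Then $F_q(K,\cdot)$ is a finite measure, and its centroid is at the origin: $$\int_{S^{n-1}} v\,dF_q(K,v)=0 .$$ -/

import Mathlib

open MeasureTheory Set Metric
open scoped ENNReal

noncomputable section

namespace ChordMeasure

/-- Euclidean `n`-space `ℝⁿ`. -/
abbrev Space (n : ℕ) : Type := EuclideanSpace ℝ (Fin n)

/-- The unit sphere `S^{n-1}` of `ℝⁿ`. -/
abbrev Sphere (n : ℕ) : Type := sphere (0 : Space n) 1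

variable {n : ℕ}

/-- The volume `ω_n` of the unit ball of `ℝⁿ`. -/
def unitBallVolume (n : ℕ) : ℝ := (volume : Measure (Space n)).real (ball 0 1)

/-- The extended radial function `ρ_{K,z}(x) = max {t ∈ ℝ : t x ∈ K - z}` of `K` with respect
to `z`. For `x ≠ 0` the set is compact, so the supremum is a maximum unless the set is empty,
and in that case the value is `0` (the usual convention and that of `sSup` on `ℝ`). -/
def radialFunction (K : ConvexBody (Space n)) (z x : Space n) : ℝ :=
  sSup {t : ℝ | z + t • x ∈ K}

/-- The dual quermassintegral `Ṽ_q(K,z)` of index `q ∈ ℝ` with respect to a point `z ∈ K`: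
`(1/n) ∫_{S_z⁺} ρ_{K,z}(u)^q du`, where `S_z⁺ = {u : ρ_{K,z}(u) > 0}` and `du` is spherical
Lebesgue measure (of total mass `n ω_n`). The value may be `∞` when `q < 0`. -/
def dualQuermassintegral (K : ConvexBody (Space n)) (q : ℝ) (z : Space n) : ℝ≥0∞ :=
  (n : ℝ≥0∞)⁻¹ * ∫⁻ u in {u : Sphere n | 0 < radialFunction K z u},
    ENNReal.ofReal (radialFunction K z u ^ q) ∂(volume : Measure (Space n)).toSphere

/-- The support function `h_K(v) = max {v · y : y ∈ K}`. -/
def supportFunction (K : ConvexBody (Space n)) (v : Space n) : ℝ :=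
  sSup ((fun y : Space n => inner ℝ v y) '' (K : Set (Space n)))

/-- The spherical image `𝛎_K(x)` of a point: the unit vectors `v` such that `x` lies in the
supporting hyperplane `H_K(v) = {y : v · y = h_K(v)}`. -/
def sphericalImage (K : ConvexBody (Space n)) (x : Space n) : Set (Sphere n) :=
  {v | inner ℝ (v : Space n) x = supportFunction K v}

/-- The regular boundary `∂'K = ∂K \ σ_K`: the boundary points of `K` with exactly one outer unit
normal. -/
def regularBoundary (K : ConvexBody (Space n)) : Set (Space n) :=
  {x | x ∈ frontier (K : Set (Space n)) ∧ ∃! v : Sphere n, v ∈ sphericalImage K x}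

/-- The spherical image map (Gauss map) `ν_K : ∂'K → S^{n-1}`. -/
def gaussMap (K : ConvexBody (Space n)) (x : regularBoundary K) : Sphere n :=
  x.2.2.choose

/-- The chord measure `F_q(K,·)` on `S^{n-1}`, given by
`F_q(K,η) = (2q/ω_n) ∫_{ν_K⁻¹(η)} Ṽ_{q-1}(K,z) dℋ^{n-1}(z)` for Borel `η`
(see `chordMeasure_apply`). It is the push-forward under the Gauss map of the measure on `∂'K`
with density `(2q/ω_n) Ṽ_{q-1}(K,·)` with respect to the `(n-1)`-dimensional Hausdorff measure
(normalized so as to agree with Lebesgue measure on `ℝ^{n-1}`). -/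
def chordMeasure (K : ConvexBody (Space n)) (q : ℝ) : Measure (Sphere n) :=
  ENNReal.ofReal (2 * q / unitBallVolume n) •
    Measure.map (gaussMap K)
      ((Measure.comap Subtype.val (μHE[n - 1] : Measure (Space n))).withDensity
        fun z : regularBoundary K => dualQuermassintegral K (q - 1) z)

/-! The Gauss map is Borel, so that the push-forward above has its intended meaning. -/

theorem inner_le_supportFunction (K : ConvexBody (Space n)) (v : Space n) {x : Space n}
    (hx : x ∈ K) : inner ℝ v x ≤ supportFunction K v := by
  apply le_csSup _ (mem_image_of_mem _ hx)
  exact (K.isCompact.image (by fun_prop)).bddAbove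

theorem mem_sphericalImage_iff (K : ConvexBody (Space n)) {x : Space n} (hx : x ∈ K)
    (v : Sphere n) :
    v ∈ sphericalImage K x ↔ ∀ y ∈ K, inner ℝ (v : Space n) y ≤ inner ℝ (v : Space n) x := by
  constructor
  · intro h y hy
    rw [show inner ℝ (v : Space n) x = supportFunction K v from h]
    exact inner_le_supportFunction K v hy
  · intro h
    apply le_antisymm (inner_le_supportFunction K v hx)
    apply csSup_le (K.nonempty.image _)
    rintro _ ⟨y, hy, rfl⟩
    exact h y hy

theorem isClosed_normalBundle (K : ConvexBody (Space n)) :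
    IsClosed {p : Space n × Sphere n |
      p.1 ∈ frontier (K : Set (Space n)) ∧ p.2 ∈ sphericalImage K p.1} := by
  have : {p : Space n × Sphere n |
      p.1 ∈ frontier (K : Set (Space n)) ∧ p.2 ∈ sphericalImage K p.1} =
      {p | p.1 ∈ frontier (K : Set (Space n))} ∩ ⋂ y ∈ (K : Set (Space n)),
        {p | inner ℝ (p.2 : Space n) y ≤ inner ℝ (p.2 : Space n) p.1} := by
    ext p
    simp only [mem_ofPred_eq, mem_inter_iff, mem_iInter]
    refine and_congr_right fun hp => ?_
    exact mem_sphericalImage_iff K (K.isClosed.frontier_subset hp) p.2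
  rw [this]
  refine (isClosed_frontier.preimage continuous_fst).inter ?_
  exact isClosed_biInter fun y _ => isClosed_le (by fun_prop) (by fun_prop)

theorem isCompact_frontier (K : ConvexBody (Space n)) :
    IsCompact (frontier (K : Set (Space n))) :=
  K.isCompact.of_isClosed_subset isClosed_frontier K.isClosed.frontier_subset

/-- The reverse spherical image of a closed set is closed. -/
theorem isClosed_reverseImage (K : ConvexBody (Space n)) {C : Set (Sphere n)} (hC : IsClosed C) :
    IsClosed {x | x ∈ frontier (K : Set (Space n)) ∧ ∃ v ∈ C, v ∈ sphericalImage K x} := by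
  have hc : IsCompact ({p : Space n × Sphere n |
      p.1 ∈ frontier (K : Set (Space n)) ∧ p.2 ∈ sphericalImage K p.1} ∩
      Prod.snd ⁻¹' C) := by
    refine ((isCompact_frontier K).prod isCompact_univ).of_isClosed_subset
      ((isClosed_normalBundle K).inter (hC.preimage continuous_snd)) ?_
    rintro p ⟨⟨h, -⟩, -⟩
    exact ⟨h, mem_univ _⟩
  convert (hc.image continuous_fst).isClosed using 1
  ext x
  constructor
  · rintro ⟨hx, v, hv, h⟩
    exact ⟨(x, v), ⟨⟨hx, h⟩, hv⟩, rfl⟩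
  · rintro ⟨⟨x, v⟩, ⟨⟨hx, h⟩, hv⟩, rfl⟩
    exact ⟨hx, v, hv, h⟩

theorem measurableSet_regularBoundary (K : ConvexBody (Space n)) :
    MeasurableSet (regularBoundary K) := by
  -- the boundary points with two normals at distance at least `1 / (m + 1)`
  let A : ℕ → Set (Space n) := fun m => {x | x ∈ frontier (K : Set (Space n)) ∧
    ∃ v ∈ sphericalImage K x, ∃ w ∈ sphericalImage K x, 1 / ((m : ℝ) + 1) ≤ dist v w}
  have hA : ∀ m, IsClosed (A m) := by
    intro m
    have hc : IsCompact {p : Space n × Sphere n × Sphere n |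
        (p.1 ∈ frontier (K : Set (Space n)) ∧ p.2.1 ∈ sphericalImage K p.1) ∧
        (p.1 ∈ frontier (K : Set (Space n)) ∧ p.2.2 ∈ sphericalImage K p.1) ∧
        1 / ((m : ℝ) + 1) ≤ dist p.2.1 p.2.2} := by
      refine ((isCompact_frontier K).prod isCompact_univ).of_isClosed_subset ?_
        fun p hp => ⟨hp.1.1, mem_univ _⟩
      refine IsClosed.inter ((isClosed_normalBundle K).preimage
        (f := fun p : Space n × Sphere n × Sphere n => (p.1, p.2.1)) (by fun_prop)) ?_
      refine IsClosed.inter ((isClosed_normalBundle K).preimage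
        (f := fun p : Space n × Sphere n × Sphere n => (p.1, p.2.2)) (by fun_prop)) ?_
      exact isClosed_le (f := fun _ : Space n × Sphere n × Sphere n => 1 / ((m : ℝ) + 1))
        (g := fun p : Space n × Sphere n × Sphere n => dist p.2.1 p.2.2)
        continuous_const (by fun_prop)
    convert (hc.image continuous_fst).isClosed using 1
    ext x
    constructor
    · rintro ⟨hx, v, hv, w, hw, h⟩
      exact ⟨(x, v, w), ⟨⟨hx, hv⟩, ⟨hx, hw⟩, h⟩, rfl⟩
    · rintro ⟨⟨x, v, w⟩, ⟨⟨hx, hv⟩, ⟨-, hw⟩, h⟩, rfl⟩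
      exact ⟨hx, v, hv, w, hw, h⟩
  have : regularBoundary K =
      {x | x ∈ frontier (K : Set (Space n)) ∧ ∃ v ∈ (univ : Set (Sphere n)),
        v ∈ sphericalImage K x} \ ⋃ m, A m := by
    ext x
    simp only [regularBoundary, mem_ofPred_eq, mem_sdiff, mem_iUnion, mem_univ, true_and]
    constructor
    · rintro ⟨hx, v, hv, huniq⟩
      refine ⟨⟨hx, v, hv⟩, ?_⟩
      rintro ⟨m, -, a, ha, b, hb, hab⟩
      rw [huniq a ha, huniq b hb, dist_self] at hab
      exact absurd hab (not_le.mpr Nat.one_div_pos_of_nat)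
    · rintro ⟨⟨hx, v, hv⟩, hno⟩
      refine ⟨hx, v, hv, fun w hw => ?_⟩
      by_contra hne
      obtain ⟨m, hm⟩ := exists_nat_one_div_lt (dist_pos.mpr hne)
      exact hno ⟨m, hx, w, hw, v, hv, hm.le⟩
  rw [this]
  exact (isClosed_reverseImage K isClosed_univ).measurableSet.diff
    (MeasurableSet.iUnion fun m => (hA m).measurableSet)

theorem gaussMap_mem (K : ConvexBody (Space n)) (x : regularBoundary K) :
    gaussMap K x ∈ sphericalImage K x :=
  x.2.2.choose_spec.1

theorem measurable_gaussMap (K : ConvexBody (Space n)) : Measurable (gaussMap K) := by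
  refine measurable_of_isClosed fun C hC => ?_
  have : gaussMap K ⁻¹' C = Subtype.val ⁻¹'
      {x | x ∈ frontier (K : Set (Space n)) ∧ ∃ v ∈ C, v ∈ sphericalImage K x} := by
    ext x
    constructor
    · intro h
      exact ⟨x.2.1, gaussMap K x, h, gaussMap_mem K x⟩
    · rintro ⟨-, v, hv, h⟩
      rw [mem_preimage, x.2.2.unique (gaussMap_mem K x) h]
      exact hv
  rw [this]
  exact (isClosed_reverseImage K hC).measurableSet.preimage measurable_subtype_coe

/-- `F_q(K,η) = (2q/ω_n) ∫_{ν_K⁻¹(η)} Ṽ_{q-1}(K,z) dℋ^{n-1}(z)` for every Borel set `η`. -/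
theorem chordMeasure_apply (K : ConvexBody (Space n)) (q : ℝ) {η : Set (Sphere n)}
    (hη : MeasurableSet η) :
    chordMeasure K q η = ENNReal.ofReal (2 * q / unitBallVolume n) *
      ∫⁻ z in Subtype.val '' (gaussMap K ⁻¹' η), dualQuermassintegral K (q - 1) z ∂μHE[n - 1] := by
  have he : MeasurableEmbedding (Subtype.val : regularBoundary K → Space n) :=
    MeasurableEmbedding.subtype_coe (measurableSet_regularBoundary K)
  have hm := measurable_gaussMap K hη
  rw [chordMeasure, Measure.smul_apply, smul_eq_mul, Measure.map_apply (measurable_gaussMap K) hη,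
    withDensity_apply _ hm]
  congr 1
  have hpre : gaussMap K ⁻¹' η = (Subtype.val : regularBoundary K → Space n) ⁻¹'
      (Subtype.val '' (gaussMap K ⁻¹' η)) :=
    (preimage_image_eq _ Subtype.val_injective).symm
  rw [← he.lintegral_map, hpre, ← he.restrict_map, he.map_comap, ← hpre,
    Measure.restrict_restrict (he.measurableSet_image.mpr hm),
    inter_eq_left.mpr (image_subset_range _ _)]

end ChordMeasure

end

/-! Fix a unit vector `w`. It is enough that the integrals of the positive and of the negative part
of `w · v` against `F_q` are finite and equal. The positive part only sees boundary points whose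
normal points upwards along `w`. There `∂K` is the graph of a concave function `top` over the
projection of `int K` to `w^⊥`, and `w · ν_K` is the reciprocal of the Jacobian of the graph map.
The area formula and Tonelli therefore turn the integral into a constant times `∫ x^(q-1) dμ_w(x)`,
where `μ_w` (`chordLengths`) is the distribution of the lengths `ρ_{K,z}(u) > 0` of chords leaving
top points `z`, for the product of Lebesgue measure on `w^⊥` with spherical measure
(`lintegral_inner_chordMeasure`).

The main point is `μ_w = μ_{-w}` (`chordLengths_neg`). On a vertical line meeting both `K` and `K -
xu` in overlapping segments, the top of the overlap is a top point of `K` that stays in `K` when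
moved by `xu`, or comes from a top point that stays in `K` when moved by `-xu`. So the projection of
`K ∩ (K - xu)` has measure equal to the sum of the measures of these two sets of top points, up to
boundary cases (`volume_overlapShadow_le`, `le_volume_overlapShadow`). Averaging over `u`, which is
symmetric under `u ↦ -u`, expresses the tails of `2 μ_w` through a quantity that does not depend on
the sign of `w`.

Finiteness is delicate for `q < 1`. A ball of radius `r` in `K` makes the projection of `K ∩ (K -
xu)` contain a copy of the projection of `K` shrunk by `1 - x/r`, so `μ_w(0,x) = O(x)`
(`exists_chordLengths_Ioo_le`), which makes `x^(q-1)` integrable for every `q > 0`. -/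

open MeasureTheory Set Metric
open scoped ENNReal

noncomputable section

namespace ChordMeasure

/-! ### Area formula for injective maps with non-contracting derivative. -/

section AreaFormula

open Module Filter Topology
open scoped NNReal

variable {E F : Type*} [NormedAddCommGroup E] [InnerProductSpace ℝ E] [FiniteDimensional ℝ E]
  [MeasurableSpace E] [BorelSpace E] [NormedAddCommGroup F] [InnerProductSpace ℝ F]
  [MeasurableSpace F] [BorelSpace F]

theorem _root_.LipschitzOnWith.euclideanHausdorffMeasure_image_le {X Y : Type*} [EMetricSpace X]
    [MeasurableSpace X] [BorelSpace X] [EMetricSpace Y] [MeasurableSpace Y] [BorelSpace Y]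
    {C : ℝ≥0} {f : X → Y} {s : Set X} (h : LipschitzOnWith C f s) (d : ℕ) :
    μHE[d] (f '' s) ≤ (C : ℝ≥0∞) ^ d * μHE[d] s := by
  simp only [Measure.euclideanHausdorffMeasure_def, Measure.smul_apply,
    Measure.nnreal_smul_coe_apply]
  rw [mul_left_comm]
  gcongr
  simpa using h.hausdorffMeasure_image_le (d := d) (by positivity)

/-- On `s` the map `f` factors through `g` by a `C`-Lipschitz map `k` of `g '' s`. -/
theorem euclideanHausdorffMeasure_image_le_of_norm_sub_le {X F : Type*} [NormedAddCommGroup F]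
    [MeasurableSpace F] [BorelSpace F] {f g : X → F} {C : ℝ≥0}
    {s : Set X} (h : ∀ x ∈ s, ∀ y ∈ s, ‖f x - f y‖ ≤ C * ‖g x - g y‖) (d : ℕ) :
    μHE[d] (f '' s) ≤ (C : ℝ≥0∞) ^ d * μHE[d] (g '' s) := by
  rcases s.eq_empty_or_nonempty with rfl | ⟨x₀, hx₀⟩
  · simp
  classical
  let k : F → F := fun z => if hz : ∃ x ∈ s, g x = z then f hz.choose else 0
  have hk : ∀ x ∈ s, k (g x) = f x := by
    intro x hx
    have hz : ∃ x' ∈ s, g x' = g x := ⟨x, hx, rfl⟩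
    simp only [k, dif_pos hz]
    have := h _ hz.choose_spec.1 x hx
    rw [hz.choose_spec.2] at this
    simpa [sub_eq_zero] using this
  have hl : LipschitzOnWith C k (g '' s) := by
    apply LipschitzOnWith.of_dist_le_mul
    rintro _ ⟨x, hx, rfl⟩ _ ⟨y, hy, rfl⟩
    rw [hk x hx, hk y hy, dist_eq_norm, dist_eq_norm]
    exact h x hx y hy
  have himg : f '' s = k '' (g '' s) := by
    rw [image_image]
    exact image_congr fun x hx => (hk x hx).symm
  rw [himg]
  exact hl.euclideanHausdorffMeasure_image_le d

/-- Since `A` shrinks no vector, the error `δ‖x - y‖` is at most `δ‖A (x - y)‖`. Hence `f` is `(1 +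
δ)`-Lipschitz relative to `A` on `s`; the converse comparison, with `(1 - δ)⁻¹`, gives the next
lemma. -/
theorem _root_.ApproximatesLinearOn.euclideanHausdorffMeasure_image_le {f : E → F} {A : E →L[ℝ] F}
    {s : Set E} {δ : ℝ≥0} (h : ApproximatesLinearOn f A s δ) (hA : ∀ v, ‖v‖ ≤ ‖A v‖) :
    μHE[finrank ℝ E] (f '' s) ≤ ((1 + δ : ℝ≥0) : ℝ≥0∞) ^ finrank ℝ E *
      (ENNReal.ofReal (A : E →ₗ[ℝ] F).normDet * volume s) := by
  rw [← LinearMap.euclideanHausdorffMeasure_image_eq_normDet_mul_volume]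
  refine euclideanHausdorffMeasure_image_le_of_norm_sub_le (fun x hx y hy => ?_) _
  have h1 := h x hx y hy
  have h2 := hA (x - y)
  have h3 : ‖f x - f y‖ ≤ ‖f x - f y - A (x - y)‖ + ‖A (x - y)‖ := by
    simpa using norm_add_le (f x - f y - A (x - y)) (A (x - y))
  have h4 : (δ : ℝ) * ‖x - y‖ ≤ δ * ‖A (x - y)‖ := by gcongr
  simp only [ContinuousLinearMap.coe_coe, ← map_sub]
  push_cast
  linarith

theorem _root_.ApproximatesLinearOn.le_euclideanHausdorffMeasure_image {f : E → F} {A : E →L[ℝ] F}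
    {s : Set E} {δ : ℝ≥0} (hδ : δ < 1) (h : ApproximatesLinearOn f A s δ)
    (hA : ∀ v, ‖v‖ ≤ ‖A v‖) :
    ENNReal.ofReal (A : E →ₗ[ℝ] F).normDet * volume s ≤
      (((1 - δ)⁻¹ : ℝ≥0) : ℝ≥0∞) ^ finrank ℝ E * μHE[finrank ℝ E] (f '' s) := by
  rw [← LinearMap.euclideanHausdorffMeasure_image_eq_normDet_mul_volume]
  refine euclideanHausdorffMeasure_image_le_of_norm_sub_le (fun x hx y hy => ?_) _
  have h1 := h x hx y hy
  have h2 := hA (x - y)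
  have h3 : ‖A (x - y)‖ ≤ ‖f x - f y - A (x - y)‖ + ‖f x - f y‖ := by
    have := norm_sub_le (f x - f y) (f x - f y - A (x - y))
    rw [sub_sub_cancel] at this
    linarith
  have h4 : (δ : ℝ) * ‖x - y‖ ≤ δ * ‖A (x - y)‖ := by gcongr
  simp only [ContinuousLinearMap.coe_coe, ← map_sub]
  rw [NNReal.coe_inv, NNReal.coe_sub hδ.le, NNReal.coe_one, ← div_eq_inv_mul, le_div_iff₀]
  · linarith
  · have : (δ : ℝ) < 1 := by exact_mod_cast hδ
    linarith

/-- A set on which the Jacobian is almost constant. -/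
theorem euclideanHausdorffMeasure_image_approx [SecondCountableTopology F] [CompleteSpace F]
    {f : E → F} {s : Set E}
    (hs : MeasurableSet s) {f' : E → E →L[ℝ] F} (hf' : ∀ x ∈ s, HasFDerivWithinAt f (f' x) s x)
    (hinj : InjOn f s) (hle : ∀ x ∈ s, ∀ v, ‖v‖ ≤ ‖f' x v‖) {δ : ℝ≥0} (h0 : 0 < δ) (h1 : δ < 1)
    (hJ : ∀ x ∈ s, ∀ y ∈ s, ENNReal.ofReal (f' x : E →ₗ[ℝ] F).normDet ≤
      (1 + δ : ℝ≥0) * ENNReal.ofReal (f' y : E →ₗ[ℝ] F).normDet) :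
    μHE[finrank ℝ E] (f '' s) ≤ ((1 + δ : ℝ≥0) : ℝ≥0∞) ^ (finrank ℝ E + 1) *
      (∫⁻ x in s, ENNReal.ofReal (f' x : E →ₗ[ℝ] F).normDet) ∧
    (∫⁻ x in s, ENNReal.ofReal (f' x : E →ₗ[ℝ] F).normDet) ≤
      (1 + δ : ℝ≥0) * (((1 - δ)⁻¹ : ℝ≥0) : ℝ≥0∞) ^ finrank ℝ E * μHE[finrank ℝ E] (f '' s) := by
  -- The linear maps of the partition below are guaranteed to be values of `f'` only when `s` is
  -- nonempty.
  rcases s.eq_empty_or_nonempty with rfl | hne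
  · simp
  obtain ⟨t, A, htd, htm, hst, happ, hex⟩ :=
    exists_partition_approximatesLinearOn_of_hasFDerivWithinAt f s f' hf' (fun _ => δ)
      fun _ => h0.ne'
  have hcont : ContinuousOn f s := fun x hx => (hf' x hx).continuousWithinAt
  have hsU : s = ⋃ n, s ∩ t n := by rw [← inter_iUnion, inter_eq_left.mpr hst]
  have hm : ∀ n, MeasurableSet (s ∩ t n) := fun n => hs.inter (htm n)
  have hd : Pairwise (Function.onFun Disjoint fun n => s ∩ t n) := fun i j hij =>
    (htd hij).mono inter_subset_right inter_subset_right
  have hH : μHE[finrank ℝ E] (f '' s) = ∑' n, μHE[finrank ℝ E] (f '' (s ∩ t n)) := by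
    conv_lhs => rw [hsU, image_iUnion]
    refine measure_iUnion (fun i j hij => ?_) fun n => ?_
    · exact (disjoint_image_image fun x hx y hy hxy => by
        have := hinj hx.1 hy.1 hxy
        subst this
        exact (disjoint_left.mp (htd hij) hx.2 hy.2).elim)
    · exact (hm n).image_of_continuousOn_injOn (hcont.mono inter_subset_left)
        (hinj.mono inter_subset_left)
  have hI : (∫⁻ x in s, ENNReal.ofReal (f' x : E →ₗ[ℝ] F).normDet) =
      ∑' n, ∫⁻ x in s ∩ t n, ENNReal.ofReal (f' x : E →ₗ[ℝ] F).normDet := by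
    conv_lhs => rw [hsU]
    exact lintegral_iUnion hm hd _
  have hA : ∀ n v, ‖v‖ ≤ ‖A n v‖ := by
    intro n
    obtain ⟨y, hy, h⟩ := hex hne n
    rw [h]
    exact hle y hy
  rw [hH, hI, ← ENNReal.tsum_mul_left, ← ENNReal.tsum_mul_left]
  constructor
  · refine ENNReal.tsum_le_tsum fun n => ?_
    obtain ⟨y, hy, h⟩ := hex hne n
    refine ((happ n).euclideanHausdorffMeasure_image_le (hA n)).trans ?_
    rw [pow_succ, mul_assoc]
    refine mul_le_mul_right ?_ _
    rw [← setLIntegral_const, ← lintegral_const_mul' _ _ ENNReal.coe_ne_top]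
    refine setLIntegral_mono' (hm n) fun x hx => ?_
    rw [h]
    exact hJ y hy x hx.1
  · refine ENNReal.tsum_le_tsum fun n => ?_
    obtain ⟨y, hy, h⟩ := hex hne n
    rw [mul_assoc]
    refine le_trans ?_ (mul_le_mul_right
      ((happ n).le_euclideanHausdorffMeasure_image h1 (hA n)) _)
    rw [← setLIntegral_const, ← lintegral_const_mul' _ _ ENNReal.coe_ne_top]
    refine setLIntegral_mono' (hm n) fun x hx => ?_
    rw [h]
    exact hJ x hx.1 y hy

/-- Slicing `s` where the Jacobian lies between consecutive powers of `1 + δ` reduces to the almost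
constant case; the error factors tend to `1` as `δ → 0`. -/
theorem euclideanHausdorffMeasure_image_eq_lintegral [SecondCountableTopology F] [CompleteSpace F]
    {f : E → F} {s : Set E}
    (hs : MeasurableSet s) {f' : E → E →L[ℝ] F} (hf' : ∀ x ∈ s, HasFDerivWithinAt f (f' x) s x)
    (hinj : InjOn f s) (hle : ∀ x ∈ s, ∀ v, ‖v‖ ≤ ‖f' x v‖)
    (hmeas : Measurable fun x => (f' x : E →ₗ[ℝ] F).normDet) :
    μHE[finrank ℝ E] (f '' s) = ∫⁻ x in s, ENNReal.ofReal (f' x : E →ₗ[ℝ] F).normDet := by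
  have hpos : ∀ x ∈ s, 0 < (f' x : E →ₗ[ℝ] F).normDet := by
    intro x hx
    refine lt_of_le_of_ne (LinearMap.normDet_nonneg _) (Ne.symm ?_)
    rw [Ne, LinearMap.normDet_eq_zero_iff_ker_ne_bot, not_not, LinearMap.ker_eq_bot']
    intro v hv
    have := hle x hx v
    rw [show f' x v = 0 from hv] at this
    simpa using this
  have hcont : ContinuousOn f s := fun x hx => (hf' x hx).continuousWithinAt
  -- the two inequalities up to a factor
  have key : ∀ δ : ℝ≥0, 0 < δ → δ < 1 →
      μHE[finrank ℝ E] (f '' s) ≤ ((1 + δ : ℝ≥0) : ℝ≥0∞) ^ (finrank ℝ E + 1) *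
        (∫⁻ x in s, ENNReal.ofReal (f' x : E →ₗ[ℝ] F).normDet) ∧
      (∫⁻ x in s, ENNReal.ofReal (f' x : E →ₗ[ℝ] F).normDet) ≤
        (1 + δ : ℝ≥0) * (((1 - δ)⁻¹ : ℝ≥0) : ℝ≥0∞) ^ finrank ℝ E *
          μHE[finrank ℝ E] (f '' s) := by
    intro δ h0 h1
    have hδ : (1 : ℝ) < 1 + δ := by
      have : (0 : ℝ) < δ := by exact_mod_cast h0
      linarith
    let T : ℤ → Set E := fun k => {x | (f' x : E →ₗ[ℝ] F).normDet ∈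
      Ico ((1 + δ : ℝ) ^ k) ((1 + δ : ℝ) ^ (k + 1))}
    have hTm : ∀ k, MeasurableSet (T k) := fun k => hmeas measurableSet_Ico
    have hTd : Pairwise (Function.onFun Disjoint T) := by
      intro i j hij
      refine disjoint_left.mpr fun x hi hj => hij ?_
      have a1 := (zpow_lt_zpow_iff_right₀ hδ).mp (hi.1.trans_lt hj.2)
      have a2 := (zpow_lt_zpow_iff_right₀ hδ).mp (hj.1.trans_lt hi.2)
      omega
    have hsT : s ⊆ ⋃ k, T k := by
      intro x hx
      obtain ⟨k, hk⟩ := exists_mem_Ico_zpow (hpos x hx) hδ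
      exact mem_iUnion.mpr ⟨k, hk⟩
    have hsU : s = ⋃ n, s ∩ T n := by rw [← inter_iUnion, inter_eq_left.mpr hsT]
    have hm : ∀ n, MeasurableSet (s ∩ T n) := fun n => hs.inter (hTm n)
    have hd : Pairwise (Function.onFun Disjoint fun n => s ∩ T n) := fun i j hij =>
      (hTd hij).mono inter_subset_right inter_subset_right
    have hH : μHE[finrank ℝ E] (f '' s) = ∑' n, μHE[finrank ℝ E] (f '' (s ∩ T n)) := by
      conv_lhs => rw [hsU, image_iUnion]
      refine measure_iUnion (fun i j hij => ?_) fun n => ?_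
      · exact (disjoint_image_image fun x hx y hy hxy => by
          have := hinj hx.1 hy.1 hxy
          subst this
          exact (disjoint_left.mp (hTd hij) hx.2 hy.2).elim)
      · exact (hm n).image_of_continuousOn_injOn (hcont.mono inter_subset_left)
          (hinj.mono inter_subset_left)
    have hI : (∫⁻ x in s, ENNReal.ofReal (f' x : E →ₗ[ℝ] F).normDet) =
        ∑' n, ∫⁻ x in s ∩ T n, ENNReal.ofReal (f' x : E →ₗ[ℝ] F).normDet := by
      conv_lhs => rw [hsU]
      exact lintegral_iUnion hm hd _
    have hp := fun k => euclideanHausdorffMeasure_image_approx (hm k)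
      (fun x hx => (hf' x hx.1).mono inter_subset_left) (hinj.mono inter_subset_left)
      (fun x hx => hle x hx.1) h0 h1 (by
        intro x hx y hy
        rw [← ENNReal.ofReal_coe_nnreal, ← ENNReal.ofReal_mul (by positivity)]
        apply ENNReal.ofReal_le_ofReal
        have a1 := hx.2.2
        have a2 := hy.2.1
        rw [zpow_add_one₀ (by positivity)] at a1
        push_cast
        nlinarith)
    rw [hH, hI, ← ENNReal.tsum_mul_left, ← ENNReal.tsum_mul_left]
    exact ⟨ENNReal.tsum_le_tsum fun k => (hp k).1, ENNReal.tsum_le_tsum fun k => (hp k).2⟩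
  have hev : ∀ᶠ δ : ℝ≥0 in 𝓝[>] 0, 0 < δ ∧ δ < 1 := by
    have := Ioo_mem_nhdsGT (show (0 : ℝ≥0) < 1 by norm_num)
    exact this
  have tid : Tendsto (fun δ : ℝ≥0 => δ) (𝓝[>] 0) (𝓝 0) := tendsto_nhdsWithin_of_tendsto_nhds tendsto_id
  have t1 : Tendsto (fun δ : ℝ≥0 => ((1 + δ : ℝ≥0) : ℝ≥0∞)) (𝓝[>] 0) (𝓝 1) := by
    have : Tendsto (fun δ : ℝ≥0 => (1 + δ : ℝ≥0)) (𝓝[>] 0) (𝓝 (1 + 0)) := tendsto_const_nhds.add tid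
    rw [add_zero] at this
    exact ENNReal.tendsto_coe.mpr this
  have t2 : Tendsto (fun δ : ℝ≥0 => (((1 - δ)⁻¹ : ℝ≥0) : ℝ≥0∞)) (𝓝[>] 0) (𝓝 1) := by
    have : Tendsto (fun δ : ℝ≥0 => ((1 - δ)⁻¹ : ℝ≥0)) (𝓝[>] 0) (𝓝 ((1 - 0)⁻¹)) :=
      (tendsto_const_nhds.sub tid).inv₀ (by simp)
    rw [tsub_zero, inv_one] at this
    exact ENNReal.tendsto_coe.mpr this
  have tpow : ∀ (g : ℝ≥0 → ℝ≥0∞) (d : ℕ), Tendsto g (𝓝[>] 0) (𝓝 1) →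
      Tendsto (fun δ => g δ ^ d) (𝓝[>] 0) (𝓝 1) := by
    intro g d hg
    have := ((ENNReal.continuous_pow d).tendsto 1).comp hg
    rwa [one_pow] at this
  have cl : ∀ (g : ℝ≥0 → ℝ≥0∞) (a b : ℝ≥0∞), Tendsto g (𝓝[>] 0) (𝓝 1) →
      (∀ δ, 0 < δ → δ < 1 → a ≤ g δ * b) → a ≤ b := by
    intro g a b hg h
    have := ENNReal.Tendsto.mul_const (b := b) hg (Or.inl one_ne_zero)
    rw [one_mul] at this
    refine ge_of_tendsto this ?_
    filter_upwards [hev] with δ hδ using h δ hδ.1 hδ.2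
  apply le_antisymm
  · exact cl _ _ _ (tpow _ _ t1) fun δ h0 h1 => (key δ h0 h1).1
  · have t3 := ENNReal.Tendsto.mul t1 (Or.inl one_ne_zero) (tpow _ (finrank ℝ E) t2)
      (Or.inl one_ne_zero)
    rw [one_mul] at t3
    exact cl _ _ _ t3 fun δ h0 h1 => (key δ h0 h1).2

/-- Because `f` is a measurable embedding of `s`, the identity holds between measures, so `φ` need
not be measurable. It will contain the dual quermassintegral, whose measurability is only
established on `∂'K`. -/
theorem lintegral_image_euclideanHausdorffMeasure [SecondCountableTopology F] [CompleteSpace F]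
    {f : E → F} {s : Set E}
    (hs : MeasurableSet s) {f' : E → E →L[ℝ] F} (hf' : ∀ x ∈ s, HasFDerivWithinAt f (f' x) s x)
    (hinj : InjOn f s) (hle : ∀ x ∈ s, ∀ v, ‖v‖ ≤ ‖f' x v‖)
    (hmeas : Measurable fun x => (f' x : E →ₗ[ℝ] F).normDet) (φ : F → ℝ≥0∞) :
    ∫⁻ z in f '' s, φ z ∂μHE[finrank ℝ E] =
      ∫⁻ x in s, ENNReal.ofReal (f' x : E →ₗ[ℝ] F).normDet * φ (f x) := by
  have hcont : ContinuousOn f s := fun x hx => (hf' x hx).continuousWithinAt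
  have hemb : MeasurableEmbedding (s.domRestrict f) := by
    refine ⟨injOn_iff_injective.mp hinj, hcont.domRestrict.measurable, fun t ht => ?_⟩
    rw [show s.domRestrict f '' t = f '' (Subtype.val '' t) by rw [image_image]; rfl]
    exact ((MeasurableEmbedding.subtype_coe hs).measurableSet_image.mpr ht).image_of_continuousOn_injOn
      (hcont.mono (by rintro _ ⟨x, -, rfl⟩; exact x.2))
      (hinj.mono (by rintro _ ⟨x, -, rfl⟩; exact x.2))
  have hmap : (μHE[finrank ℝ E] : Measure F).restrict (f '' s) =
      Measure.map (s.domRestrict f) (Measure.comap Subtype.val (volume.withDensity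
        fun x => ENNReal.ofReal (f' x : E →ₗ[ℝ] F).normDet)) := by
    ext A hA
    rw [hemb.map_apply, (MeasurableEmbedding.subtype_coe hs).comap_apply,
      show Subtype.val '' (s.domRestrict f ⁻¹' A) = s ∩ f ⁻¹' A by
        ext x; simp [Set.domRestrict, and_comm],
      Measure.restrict_apply hA]
    have hsA : MeasurableSet (s ∩ f ⁻¹' A) := by
      have := (MeasurableEmbedding.subtype_coe hs).measurableSet_image.mpr
        (hcont.domRestrict.measurable hA)
      convert this using 1
      ext x; simp [and_comm]
    rw [withDensity_apply _ hsA, inter_comm A, ← image_inter_preimage,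
      euclideanHausdorffMeasure_image_eq_lintegral hsA
        (fun x hx => (hf' x hx.1).mono inter_subset_left) (hinj.mono inter_subset_left)
        (fun x hx => hle x hx.1) hmeas]
  rw [hmap, hemb.lintegral_map]
  have : ∀ x : s, φ (s.domRestrict f x) = (fun x => φ (f x)) x.1 := fun _ => rfl
  simp_rw [this]
  rw [← (MeasurableEmbedding.subtype_coe hs).lintegral_map (fun x => φ (f x)),
    (MeasurableEmbedding.subtype_coe hs).map_comap, Subtype.range_coe,
    restrict_withDensity hs, lintegral_withDensity_eq_lintegral_mul_non_measurable _
      hmeas.ennreal_ofReal]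
  · rfl
  · exact Filter.Eventually.of_forall fun _ => ENNReal.ofReal_lt_top

end AreaFormula

/-! ### Orthogonal splittings and the Jacobian of a graph. -/

section Frame

open Module

/-- A splitting of `ℝ^{m+1}` into a copy of `ℝ^m` and an orthogonal unit direction `w`. -/
structure Frame (m : ℕ) where
  ι : Space m →ₗᵢ[ℝ] Space (m + 1)
  w : Space (m + 1)
  norm_w : ‖w‖ = 1
  inner_w_ι : ∀ y, inner ℝ w (ι y) = (0 : ℝ)

namespace Frame

variable {m : ℕ} (Φ : Frame m)

/-- The same splitting with the opposite direction. -/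
def neg : Frame m where
  ι := Φ.ι
  w := -Φ.w
  norm_w := by rw [norm_neg, Φ.norm_w]
  inner_w_ι y := by rw [inner_neg_left, Φ.inner_w_ι, neg_zero]

/-- The point with horizontal part `y` and height `s`. -/
def point (y : Space m) (s : ℝ) : Space (m + 1) := Φ.ι y + s • Φ.w

/-- The orthogonal projection along `w`. -/
def proj : Space (m + 1) →L[ℝ] Space m := Φ.ι.toContinuousLinearMap.adjoint

theorem inner_proj (x : Space (m + 1)) (y : Space m) :
    inner ℝ (Φ.proj x) y = (inner ℝ x (Φ.ι y) : ℝ) :=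
  ContinuousLinearMap.adjoint_inner_left _ _ _

theorem inner_w_w : inner ℝ Φ.w Φ.w = (1 : ℝ) := by
  rw [real_inner_self_eq_norm_sq, Φ.norm_w, one_pow]

theorem inner_ι_ι (x y : Space m) : inner ℝ (Φ.ι x) (Φ.ι y) = (inner ℝ x y : ℝ) :=
  Φ.ι.inner_map_map x y

theorem inner_ι_w (y : Space m) : inner ℝ (Φ.ι y) Φ.w = (0 : ℝ) := by
  rw [real_inner_comm, Φ.inner_w_ι]

@[simp] theorem proj_ι (y : Space m) : Φ.proj (Φ.ι y) = y := by
  refine ext_inner_right ℝ fun v => ?_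
  rw [inner_proj, inner_ι_ι]

@[simp] theorem proj_w : Φ.proj Φ.w = 0 := by
  refine ext_inner_right ℝ fun v => ?_
  rw [inner_proj, inner_w_ι, inner_zero_left]

@[simp] theorem proj_point (y : Space m) (s : ℝ) : Φ.proj (Φ.point y s) = y := by
  simp [point]

@[simp] theorem inner_w_point (y : Space m) (s : ℝ) : inner ℝ Φ.w (Φ.point y s) = s := by
  simp [point, inner_add_right, inner_smul_right, Φ.inner_w_ι, Φ.norm_w]

theorem point_add (y y' : Space m) (s s' : ℝ) : Φ.point (y + y') (s + s') = Φ.point y s + Φ.point y' s' := by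
  simp only [point, map_add, add_smul]
  abel

theorem point_smul (c : ℝ) (y : Space m) (s : ℝ) : Φ.point (c • y) (c * s) = c • Φ.point y s := by
  simp only [point, map_smul, smul_add, mul_smul]

theorem point_surjective (x : Space (m + 1)) : ∃ y s, Φ.point y s = x := by
  let L : Space m × ℝ →ₗ[ℝ] Space (m + 1) :=
    Φ.ι.toLinearMap.coprod (LinearMap.toSpanSingleton ℝ _ Φ.w)
  have hL : ∀ p, L p = Φ.point p.1 p.2 := fun p => by simp [L, point]
  have hinj : Function.Injective L := by
    intro p q h
    rw [hL, hL] at h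
    refine Prod.ext ?_ ?_
    · simpa using congrArg Φ.proj h
    · simpa using congrArg (inner ℝ Φ.w) h
  have hsurj := (LinearMap.injective_iff_surjective_of_finrank_eq_finrank (f := L)
    (by simp)).mp hinj
  obtain ⟨p, hp⟩ := hsurj x
  exact ⟨p.1, p.2, by rw [← hL, hp]⟩

theorem point_proj (x : Space (m + 1)) : Φ.point (Φ.proj x) (inner ℝ Φ.w x) = x := by
  obtain ⟨y, s, rfl⟩ := Φ.point_surjective x
  simp

theorem proj_surjective : Function.Surjective Φ.proj := fun y => ⟨Φ.ι y, Φ.proj_ι y⟩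

theorem isOpenMap_proj : IsOpenMap Φ.proj := Φ.proj.isOpenMap Φ.proj_surjective

theorem norm_point_sq (y : Space m) (s : ℝ) : ‖Φ.point y s‖ ^ 2 = ‖y‖ ^ 2 + s ^ 2 := by
  rw [point, ← real_inner_self_eq_norm_sq, inner_add_left, inner_add_right, inner_add_right,
    inner_smul_left, inner_smul_right, inner_smul_left, inner_smul_right, inner_ι_ι, inner_ι_w,
    inner_w_ι, inner_w_w, real_inner_self_eq_norm_sq]
  simp
  ring

theorem norm_le_norm_point (y : Space m) (s : ℝ) : ‖y‖ ≤ ‖Φ.point y s‖ := by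
  rw [← sq_le_sq₀ (norm_nonneg _) (norm_nonneg _), norm_point_sq]
  nlinarith [sq_nonneg s]

@[fun_prop] theorem continuous_point : Continuous fun p : Space m × ℝ => Φ.point p.1 p.2 := by
  unfold point
  have := Φ.ι.continuous
  fun_prop

/-- The derivative of a graph map. -/
def graphDeriv (p : Space m →L[ℝ] ℝ) : Space m →L[ℝ] Space (m + 1) :=
  Φ.ι.toContinuousLinearMap + p.smulRight Φ.w

theorem graphDeriv_apply (p : Space m →L[ℝ] ℝ) (v : Space m) :
    Φ.graphDeriv p v = Φ.point v (p v) := by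
  simp [graphDeriv, point]

theorem hasFDerivAt_graph {t : Space m → ℝ} {p : Space m →L[ℝ] ℝ} {y : Space m}
    (h : HasFDerivAt t p y) : HasFDerivAt (fun y => Φ.point y (t y)) (Φ.graphDeriv p) y :=
  (Φ.ι.toContinuousLinearMap.hasFDerivAt).add (h.smul_const Φ.w)

/-- With `a` the gradient representing `p`, the Gram matrix is `1 + a aᵀ`, of determinant `1 +
‖a‖²`. -/
theorem normDet_graphDeriv (p : Space m →L[ℝ] ℝ) :
    (Φ.graphDeriv p : Space m →ₗ[ℝ] Space (m + 1)).normDet = √(1 + ‖p‖ ^ 2) := by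
  have hsq := LinearMap.normDet_sq_eq_det_gram (𝕜 := ℝ)
    (Φ.graphDeriv p : Space m →ₗ[ℝ] Space (m + 1)) (EuclideanSpace.basisFun (Fin m) ℝ)
  let a : Space m := (InnerProductSpace.toDual ℝ (Space m)).symm p
  have ha : ∀ v, p v = inner ℝ a v := fun v =>
    (InnerProductSpace.toDual_symm_apply (𝕜 := ℝ) (x := v) (y := p)).symm
  have hn : ‖a‖ = ‖p‖ := LinearIsometryEquiv.norm_map _ _
  have hgram : Matrix.gram ℝ (fun i => (Φ.graphDeriv p : Space m →ₗ[ℝ] Space (m + 1))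
      (EuclideanSpace.basisFun (Fin m) ℝ i)) =
      1 + Matrix.replicateCol Unit (fun i => a i) * Matrix.replicateRow Unit (fun i => a i) := by
    ext i j
    rw [Matrix.gram_apply]
    simp only [ContinuousLinearMap.coe_coe, graphDeriv_apply, point]
    rw [inner_add_left, inner_add_right, inner_add_right,
      inner_smul_left, inner_smul_right, inner_smul_left, inner_smul_right, inner_ι_ι, inner_ι_w,
      inner_w_ι, inner_w_w, ha, ha]
    simp [Matrix.one_apply, Matrix.mul_apply, EuclideanSpace.inner_single_right, eq_comm]
  rw [hgram, Matrix.det_one_add_replicateCol_mul_replicateRow] at hsq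
  have h2 : (fun i => a i) ⬝ᵥ (fun i => a i) = ‖p‖ ^ 2 := by
    rw [← hn, EuclideanSpace.real_norm_sq_eq]
    simp [dotProduct, sq]
  rw [h2] at hsq
  rw [eq_comm, Real.sqrt_eq_iff_mul_self_eq (by positivity) (LinearMap.normDet_nonneg _), ← sq]
  simpa using hsq.symm

end Frame

end Frame

/-! ### The upper boundary as the graph of a concave function. -/

section TopFunction

open Filter Topology
open scoped NNReal

variable {m : ℕ} (K : ConvexBody (Space (m + 1))) (Φ : Frame m)

/-- The projection of the interior of `K`. -/
def shadow : Set (Space m) := Φ.proj '' interior (K : Set (Space (m + 1)))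

/-- The height of the highest point of `K` above `y`. -/
def top (y : Space m) : ℝ := sSup {s | Φ.point y s ∈ K}

/-- The highest point of `K` above `y`. -/
def topPoint (y : Space m) : Space (m + 1) := Φ.point y (top K Φ y)

theorem isOpen_shadow : IsOpen (shadow K Φ) := Φ.isOpenMap_proj _ isOpen_interior

theorem convex_shadow : Convex ℝ (shadow K Φ) :=
  K.convex.interior.linear_image Φ.proj.toLinearMap

theorem shadow_subset : shadow K Φ ⊆ Φ.proj '' (K : Set (Space (m + 1))) :=
  image_mono interior_subset

variable {K} in
theorem bddAbove_heights (y : Space m) : BddAbove {s | Φ.point y s ∈ K} := by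
  obtain ⟨C, hC⟩ := (K.isCompact.image (f := fun x => (inner ℝ Φ.w x : ℝ)) (by fun_prop)).bddAbove
  exact ⟨C, fun s hs => by simpa using hC (mem_image_of_mem _ hs)⟩

variable {K} in
theorem le_top {y : Space m} {s : ℝ} (h : Φ.point y s ∈ K) : s ≤ top K Φ y :=
  le_csSup (bddAbove_heights Φ y) h

variable {K} in
theorem topPoint_mem {y : Space m} (hy : y ∈ Φ.proj '' (K : Set (Space (m + 1)))) :
    topPoint K Φ y ∈ K := by
  have hc : IsClosed {s | Φ.point y s ∈ K} :=
    K.isClosed.preimage (f := fun s => Φ.point y s) (by fun_prop)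
  obtain ⟨x, hx, rfl⟩ := hy
  exact hc.csSup_mem ⟨inner ℝ Φ.w x, by rw [mem_ofPred_eq, Φ.point_proj]; exact hx⟩
    (bddAbove_heights Φ _)

variable {K} in
theorem topPoint_mem_of_mem_shadow {y : Space m} (hy : y ∈ shadow K Φ) : topPoint K Φ y ∈ K :=
  topPoint_mem Φ (shadow_subset K Φ hy)

@[simp] theorem proj_topPoint (y : Space m) : Φ.proj (topPoint K Φ y) = y := Φ.proj_point _ _

variable {K} in
theorem lt_top_of_mem_interior {y : Space m} {s : ℝ}
    (h : Φ.point y s ∈ interior (K : Set (Space (m + 1)))) : s < top K Φ y := by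
  have hev : ∀ᶠ r in 𝓝 s, Φ.point y r ∈ interior (K : Set (Space (m + 1))) :=
    (show Continuous fun r => Φ.point y r by fun_prop).continuousAt.preimage_mem_nhds
      (isOpen_interior.mem_nhds h)
  obtain ⟨r, hr, hsr⟩ := ((hev.filter_mono nhdsWithin_le_nhds).and
    (self_mem_nhdsWithin (s := Ioi s))).exists
  exact lt_of_lt_of_le hsr (le_top Φ (interior_subset hr))

variable {K} in
theorem topPoint_mem_frontier {y : Space m} (hy : y ∈ shadow K Φ) :
    topPoint K Φ y ∈ frontier (K : Set (Space (m + 1))) :=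
  ⟨subset_closure (topPoint_mem_of_mem_shadow Φ hy), fun h =>
    lt_irrefl _ (lt_top_of_mem_interior Φ h)⟩

variable {K} in
/-- Points of the shadow lie below the top point and above an interior point. -/
theorem exists_point_mem_interior {y : Space m} (hy : y ∈ shadow K Φ) :
    ∃ s < top K Φ y, Φ.point y s ∈ interior (K : Set (Space (m + 1))) := by
  obtain ⟨x, hx, rfl⟩ := hy
  rw [← Φ.point_proj x] at hx
  exact ⟨_, lt_top_of_mem_interior Φ hx, hx⟩

theorem concaveOn_top : ConcaveOn ℝ (Φ.proj '' (K : Set (Space (m + 1)))) (top K Φ) := by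
  refine ⟨K.convex.linear_image Φ.proj.toLinearMap, fun x hx y hy a b ha hb hab => ?_⟩
  apply le_top
  have := K.convex (topPoint_mem Φ hx) (topPoint_mem Φ hy) ha hb hab
  rwa [topPoint, topPoint, ← Φ.point_smul, ← Φ.point_smul, ← Φ.point_add] at this

theorem concaveOn_top_shadow : ConcaveOn ℝ (shadow K Φ) (top K Φ) :=
  (concaveOn_top K Φ).subset (shadow_subset K Φ) (convex_shadow K Φ)

theorem locallyLipschitzOn_top : LocallyLipschitzOn (shadow K Φ) (top K Φ) :=
  (concaveOn_top_shadow K Φ).locallyLipschitzOn (isOpen_shadow K Φ)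

theorem continuousOn_top : ContinuousOn (top K Φ) (shadow K Φ) :=
  (locallyLipschitzOn_top K Φ).continuousOn

theorem continuousOn_topPoint : ContinuousOn (topPoint K Φ) (shadow K Φ) := by
  have h : ContinuousOn (fun y => (y, top K Φ y)) (shadow K Φ) :=
    continuousOn_id.prodMk (continuousOn_top K Φ)
  exact Φ.continuous_point.comp_continuousOn h

theorem injective_topPoint : Function.Injective (topPoint K Φ) := fun x y h => by
  simpa using congrArg Φ.proj h

theorem lipschitzOnWith_topPoint {C : ℝ≥0} {s : Set (Space m)}
    (h : LipschitzOnWith C (top K Φ) s) : LipschitzOnWith (1 + C) (topPoint K Φ) s := by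
  refine LipschitzOnWith.of_dist_le_mul fun x hx y hy => ?_
  have h1 := h.dist_le_mul x hx y hy
  rw [dist_eq_norm, Real.norm_eq_abs] at h1
  rw [dist_eq_norm, topPoint, topPoint, Frame.point, Frame.point]
  have : Φ.ι x + top K Φ x • Φ.w - (Φ.ι y + top K Φ y • Φ.w) =
      Φ.ι (x - y) + (top K Φ x - top K Φ y) • Φ.w := by
    rw [map_sub, sub_smul]; abel
  rw [this]
  refine (norm_add_le _ _).trans ?_
  rw [Φ.ι.norm_map, norm_smul, Φ.norm_w, mul_one, Real.norm_eq_abs, ← dist_eq_norm]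
  push_cast
  linarith

/-- The points of the shadow above which the boundary is smooth. -/
def smoothShadow : Set (Space m) := {y | y ∈ shadow K Φ ∧ DifferentiableAt ℝ (top K Φ) y}

theorem measurableSet_smoothShadow : MeasurableSet (smoothShadow K Φ) :=
  (isOpen_shadow K Φ).measurableSet.inter (measurableSet_of_differentiableAt ℝ _)

/-- The slope of `top` may blow up at the edge of the shadow, so there need not be a global
Lipschitz constant; the Lindelöf property leaves countably many local ones. -/
theorem exists_countable_lipschitz_cover : ∃ T : Set (Space m), T.Countable ∧
    ∃ V : Space m → Set (Space m), shadow K Φ ⊆ ⋃ x ∈ T, V x ∧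
      ∀ x ∈ T, IsOpen (V x) ∧ ∃ C, LipschitzOnWith C (top K Φ) (V x) := by
  have h : ∀ x ∈ shadow K Φ, ∃ V : Set (Space m), x ∈ V ∧ IsOpen V ∧
      ∃ C, LipschitzOnWith C (top K Φ) V := by
    intro x hx
    obtain ⟨C, t, ht, hC⟩ := locallyLipschitzOn_top K Φ hx
    rw [(isOpen_shadow K Φ).nhdsWithin_eq hx] at ht
    obtain ⟨V, hVt, hV, hxV⟩ := _root_.mem_nhds_iff.mp ht
    exact ⟨V, hxV, hV, C, hC.mono hVt⟩
  choose! V hxV hV hC using h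
  obtain ⟨T, hTs, hT, hcov⟩ := TopologicalSpace.countable_cover_nhdsWithin (s := shadow K Φ)
    (f := V) fun x hx => mem_nhdsWithin_of_mem_nhds ((hV x hx).mem_nhds (hxV x hx))
  exact ⟨T, hT, V, hcov, fun x hx => ⟨hV x (hTs hx), hC x (hTs hx)⟩⟩

/-- Rademacher's theorem on each piece of the Lipschitz cover. -/
theorem volume_shadow_diff_smoothShadow :
    volume (shadow K Φ \ smoothShadow K Φ) = 0 := by
  obtain ⟨T, hT, V, hcov, hV⟩ := exists_countable_lipschitz_cover K Φ
  refine measure_mono_null (t := ⋃ x ∈ T, {y | y ∈ V x ∧ ¬ DifferentiableAt ℝ (top K Φ) y}) ?_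
    ((measure_biUnion_null_iff hT).mpr fun x hx => ?_)
  · rintro y ⟨hy, hny⟩
    obtain ⟨x, hx, hyx⟩ := mem_iUnion₂.mp (hcov hy)
    exact mem_iUnion₂.mpr ⟨x, hx, hyx, fun hd => hny ⟨hy, hd⟩⟩
  · obtain ⟨hVo, C, hC⟩ := hV x hx
    have := hC.ae_differentiableWithinAt_of_mem (μ := volume)
    refine measure_mono_null ?_ (ae_iff.mp this)
    rintro y ⟨hy, hny⟩ h
    exact hny ((h hy).differentiableAt (hVo.mem_nhds hy))

theorem euclideanHausdorffMeasure_topPoint_image_eq_zero {N : Set (Space m)}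
    (hN : N ⊆ shadow K Φ) (h0 : volume N = 0) : μHE[m] (topPoint K Φ '' N) = 0 := by
  obtain ⟨T, hT, V, hcov, hV⟩ := exists_countable_lipschitz_cover K Φ
  refine measure_mono_null (t := ⋃ x ∈ T, topPoint K Φ '' (N ∩ V x)) ?_
    ((measure_biUnion_null_iff hT).mpr fun x hx => ?_)
  · rintro _ ⟨y, hy, rfl⟩
    obtain ⟨x, hx, hyx⟩ := mem_iUnion₂.mp (hcov (hN hy))
    exact mem_iUnion₂.mpr ⟨x, hx, y, ⟨hy, hyx⟩, rfl⟩
  · obtain ⟨hVo, C, hC⟩ := hV x hx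
    have hl := ((lipschitzOnWith_topPoint K Φ hC).mono
      (inter_subset_right (s := N))).euclideanHausdorffMeasure_image_le m
    rw [EuclideanSpace.euclideanHausdorffMeasure_eq_volume,
      measure_mono_null inter_subset_left h0, mul_zero] at hl
    exact le_antisymm hl zero_le

end TopFunction

/-! ### Normals of the upper boundary and change of variables to the projection. -/

section Normals

variable {m : ℕ} {K : ConvexBody (Space (m + 1))} (Φ : Frame m)

theorem inner_le_of_forall_mem_interior {n : ℕ} {K : ConvexBody (Space n)}
    (hK : (interior (K : Set (Space n))).Nonempty) {a : Space n} {c : ℝ}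
    (h : ∀ x ∈ interior (K : Set (Space n)), (inner ℝ a x : ℝ) < c) :
    ∀ x ∈ K, (inner ℝ a x : ℝ) ≤ c := by
  intro x hx
  have hx' : x ∈ closure (interior (K : Set (Space n))) := by
    rw [K.convex.closure_interior_eq_closure_of_nonempty_interior hK]
    exact subset_closure hx
  exact closure_minimal (fun y hy => (h y hy).le)
    (isClosed_le (by fun_prop) continuous_const : IsClosed {x : Space n | (inner ℝ a x : ℝ) ≤ c}) hx'

/-- A nonzero outer normal vector gives a unit one. -/
theorem exists_mem_sphericalImage {n : ℕ} {K : ConvexBody (Space n)} {z a : Space n} (hz : z ∈ K)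
    (ha : a ≠ 0) (h : ∀ x ∈ K, (inner ℝ a x : ℝ) ≤ inner ℝ a z) :
    ∃ v ∈ sphericalImage K z, (v : Space n) = ‖a‖⁻¹ • a := by
  refine ⟨⟨‖a‖⁻¹ • a, ?_⟩, ?_, rfl⟩
  · rw [mem_sphere_zero_iff_norm, norm_smul, norm_inv, norm_norm,
      inv_mul_cancel₀ (norm_ne_zero_iff.mpr ha)]
  · rw [mem_sphericalImage_iff K hz]
    intro y hy
    simp only [inner_smul_left]
    exact mul_le_mul_of_nonneg_left (h y hy) (by simp)

theorem sphericalImage_nonempty {n : ℕ} {K : ConvexBody (Space n)}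
    (hK : (interior (K : Set (Space n))).Nonempty) {z : Space n}
    (hz : z ∈ frontier (K : Set (Space n))) : (sphericalImage K z).Nonempty := by
  obtain ⟨f, hf⟩ := geometric_hahn_banach_open_point K.convex.interior isOpen_interior hz.2
  let a : Space n := (InnerProductSpace.toDual ℝ (Space n)).symm f
  have ha : ∀ v, f v = inner ℝ a v := fun v =>
    (InnerProductSpace.toDual_symm_apply (𝕜 := ℝ) (x := v) (y := f)).symm
  have ha0 : a ≠ 0 := by
    intro h0
    obtain ⟨x, hx⟩ := hK
    have := hf x hx
    rw [ha, ha, h0, inner_zero_left, inner_zero_left] at this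
    exact lt_irrefl _ this
  have hle := inner_le_of_forall_mem_interior hK (a := a) (c := inner ℝ a z)
    fun x hx => by rw [← ha, ← ha]; exact hf x hx
  obtain ⟨v, hv, -⟩ := exists_mem_sphericalImage (K.isClosed.frontier_subset hz) ha0 hle
  exact ⟨v, hv⟩

/-- The outer unit normals at a smooth top point. -/
theorem inner_eq_of_mem_sphericalImage {y : Space m} (hy : y ∈ smoothShadow K Φ)
    {v : Sphere (m + 1)} (hv : v ∈ sphericalImage K (topPoint K Φ y)) :
    inner ℝ Φ.w (v : Space (m + 1)) = (√(1 + ‖fderiv ℝ (top K Φ) y‖ ^ 2))⁻¹ ∧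
    Φ.proj v = -(inner ℝ Φ.w (v : Space (m + 1)) : ℝ) •
      (InnerProductSpace.toDual ℝ (Space m)).symm (fderiv ℝ (top K Φ) y) := by
  obtain ⟨hys, hd⟩ := hy
  set p := fderiv ℝ (top K Φ) y
  set a : Space m := (InnerProductSpace.toDual ℝ (Space m)).symm p with hadef
  have ha : ∀ v, p v = inner ℝ a v := fun v =>
    (InnerProductSpace.toDual_symm_apply (𝕜 := ℝ) (x := v) (y := p)).symm
  have hn : ‖a‖ = ‖p‖ := LinearIsometryEquiv.norm_map _ _
  rw [mem_sphericalImage_iff K (topPoint_mem_of_mem_shadow Φ hys)] at hv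
  set c : ℝ := inner ℝ Φ.w (v : Space (m + 1)) with hc
  set b : Space m := Φ.proj v with hb
  have hinner : ∀ y' s, inner ℝ (v : Space (m + 1)) (Φ.point y' s) = (inner ℝ b y' + c * s : ℝ) := by
    intro y' s
    rw [Frame.point, inner_add_right, inner_smul_right, ← Φ.inner_proj, hc, real_inner_comm Φ.w,
      mul_comm]
  -- A normal maximizes its linear functional over the graph, so the horizontal derivative vanishes:
  -- `b + c • a = 0`.
  have hmax : IsLocalMax (fun y' => (inner ℝ b y' + c * top K Φ y' : ℝ)) y := by
    filter_upwards [(isOpen_shadow K Φ).mem_nhds hys] with y' hy'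
    have := hv _ (topPoint_mem_of_mem_shadow Φ hy')
    rwa [topPoint, topPoint, hinner, hinner] at this
  have hder : HasFDerivAt (fun y' => (inner ℝ b y' + c * top K Φ y' : ℝ))
      (innerSL ℝ b + c • p) y :=
    ((innerSL ℝ b).hasFDerivAt).add (hd.hasFDerivAt.const_mul c)
  have hzero := hmax.hasFDerivAt_eq_zero hder
  have hba : b = -c • a := by
    refine ext_inner_right ℝ fun u => ?_
    have := DFunLike.congr_fun hzero u
    simp only [add_apply, smul_apply, innerSL_apply_apply,
      zero_apply, smul_eq_mul, ha] at this
    rw [inner_smul_left]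
    simp only [conj_trivial]
    linarith
  -- The sign comes from an interior point vertically below the top point.
  have hc0 : 0 ≤ c := by
    obtain ⟨s, hs, hint⟩ := exists_point_mem_interior Φ hys
    have := hv _ (interior_subset hint)
    rw [topPoint, hinner, hinner] at this
    by_contra! hneg
    nlinarith
  have hv1 : ‖(v : Space (m + 1))‖ ^ 2 = 1 := by
    rw [mem_sphere_zero_iff_norm.mp v.2, one_pow]
  rw [← Φ.point_proj (v : Space (m + 1)), Φ.norm_point_sq, ← hb, ← hc, hba, norm_smul, mul_pow,
    hn, norm_neg, Real.norm_eq_abs, sq_abs] at hv1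
  refine ⟨?_, hba⟩
  refine eq_inv_of_mul_eq_one_left ?_
  have hs : √(1 + ‖p‖ ^ 2) ^ 2 = 1 + ‖p‖ ^ 2 := Real.sq_sqrt (by positivity)
  have h1 : (c * √(1 + ‖p‖ ^ 2)) ^ 2 = 1 := by rw [mul_pow, hs]; linarith
  have h2 : 0 ≤ c * √(1 + ‖p‖ ^ 2) := by positivity
  nlinarith

theorem topPoint_mem_regularBoundary (hK : (interior (K : Set (Space (m + 1)))).Nonempty)
    {y : Space m} (hy : y ∈ smoothShadow K Φ) : topPoint K Φ y ∈ regularBoundary K := by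
  have hfr := topPoint_mem_frontier Φ hy.1
  obtain ⟨v, hv⟩ := sphericalImage_nonempty hK hfr
  refine ⟨hfr, v, hv, fun u hu => ?_⟩
  obtain ⟨h1, h2⟩ := inner_eq_of_mem_sphericalImage Φ hy hv
  obtain ⟨h3, h4⟩ := inner_eq_of_mem_sphericalImage Φ hy hu
  apply Subtype.ext
  rw [← Φ.point_proj (v : Space (m + 1)), ← Φ.point_proj (u : Space (m + 1)), h2, h4, h1, h3]

/-- The Gauss map, extended by zero. -/
def gaussVec {n : ℕ} (K : ConvexBody (Space n)) (z : Space n) : Space n :=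
  open Classical in if h : z ∈ regularBoundary K then (gaussMap K ⟨z, h⟩ : Space n) else 0

theorem gaussVec_coe {n : ℕ} (K : ConvexBody (Space n)) (z : regularBoundary K) :
    gaussVec K z = gaussMap K z := by
  simp [gaussVec]

theorem gaussVec_of_notMem {n : ℕ} {K : ConvexBody (Space n)} {z : Space n}
    (h : z ∉ regularBoundary K) : gaussVec K z = 0 := by
  simp [gaussVec, h]

theorem inner_gaussVec_topPoint (hK : (interior (K : Set (Space (m + 1)))).Nonempty)
    {y : Space m} (hy : y ∈ smoothShadow K Φ) :
    inner ℝ Φ.w (gaussVec K (topPoint K Φ y)) = (√(1 + ‖fderiv ℝ (top K Φ) y‖ ^ 2))⁻¹ := by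
  have h := topPoint_mem_regularBoundary Φ hK hy
  rw [gaussVec_coe K ⟨_, h⟩]
  exact (inner_eq_of_mem_sphericalImage Φ hy (gaussMap_mem K ⟨_, h⟩)).1

/-- If `z` did not project into the open shadow, separating its projection would give a horizontal
outer normal at `z`. As the normal is unique, `w · ν_K(z)` would be `0`. Over the shadow, a positive
vertical component of the normal forbids points of `K` above `z`. -/
theorem exists_topPoint_eq_of_inner_pos (hK : (interior (K : Set (Space (m + 1)))).Nonempty)
    {z : Space (m + 1)} (h : 0 < (inner ℝ Φ.w (gaussVec K z) : ℝ)) :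
    ∃ y ∈ shadow K Φ, topPoint K Φ y = z := by
  have hz : z ∈ regularBoundary K := by
    by_contra hz
    rw [gaussVec_of_notMem hz, inner_zero_right] at h
    exact lt_irrefl _ h
  rw [gaussVec_coe K ⟨z, hz⟩] at h
  have hzK : z ∈ K := K.isClosed.frontier_subset hz.1
  have hg := gaussMap_mem K ⟨z, hz⟩
  rw [mem_sphericalImage_iff K hzK] at hg
  refine ⟨Φ.proj z, ?_, ?_⟩
  · by_contra hns
    obtain ⟨f, hf⟩ := geometric_hahn_banach_open_point (convex_shadow K Φ) (isOpen_shadow K Φ) hns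
    let a : Space m := (InnerProductSpace.toDual ℝ (Space m)).symm f
    have ha : ∀ v, f v = inner ℝ a v := fun v =>
      (InnerProductSpace.toDual_symm_apply (𝕜 := ℝ) (x := v) (y := f)).symm
    have ha0 : a ≠ 0 := by
      intro h0
      obtain ⟨x, hx⟩ := hK
      have := hf _ (mem_image_of_mem _ hx)
      rw [ha, ha, h0, inner_zero_left, inner_zero_left] at this
      exact lt_irrefl _ this
    have hle := inner_le_of_forall_mem_interior hK (a := Φ.ι a) (c := inner ℝ (Φ.ι a) z)
      fun x hx => by
        have := hf _ (mem_image_of_mem _ hx)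
        rwa [ha, ha, real_inner_comm, real_inner_comm _ a, Φ.inner_proj, Φ.inner_proj,
          real_inner_comm, real_inner_comm _ z] at this
    obtain ⟨v, hv, hva⟩ := exists_mem_sphericalImage hzK
      (fun h0 => ha0 (Φ.ι.injective (by rw [h0, map_zero]))) hle
    rw [hz.2.unique (gaussMap_mem K ⟨z, hz⟩) hv, hva, inner_smul_right, Φ.inner_w_ι,
      mul_zero] at h
    exact lt_irrefl _ h
  · have hz' : Φ.point (Φ.proj z) (inner ℝ Φ.w z) ∈ K := by rwa [Φ.point_proj]
    have hle := le_top Φ hz'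
    have ht := hg _ (topPoint_mem Φ ⟨z, hzK, rfl⟩)
    set v : Space (m + 1) := (gaussMap K ⟨z, hz⟩).1
    have hexp : ∀ y s, (inner ℝ v (Φ.point y s) : ℝ) = inner ℝ v (Φ.ι y) + s * inner ℝ Φ.w v := by
      intro y s
      rw [Frame.point, inner_add_right, inner_smul_right, real_inner_comm v Φ.w]
    have hvz : (inner ℝ v z : ℝ) = inner ℝ v (Φ.ι (Φ.proj z)) + inner ℝ Φ.w z * inner ℝ Φ.w v := by
      rw [← hexp, Φ.point_proj]
    have h5 : top K Φ (Φ.proj z) = inner ℝ Φ.w z := by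
      refine le_antisymm (le_of_mul_le_mul_right ?_ h) hle
      rw [topPoint, hexp, hvz] at ht
      linarith
    rw [topPoint, h5, Φ.point_proj]

/-- Integration over the part of the boundary whose normals point upwards, in terms of the
projection. -/
theorem lintegral_inner_gaussVec (hK : (interior (K : Set (Space (m + 1)))).Nonempty)
    (φ : Space (m + 1) → ℝ≥0∞) :
    ∫⁻ z, ENNReal.ofReal (inner ℝ Φ.w (gaussVec K z)) * φ z ∂μHE[m] =
      ∫⁻ y in shadow K Φ, φ (topPoint K Φ y) := by
  set ψ : Space (m + 1) → ℝ≥0∞ := fun z => ENNReal.ofReal (inner ℝ Φ.w (gaussVec K z)) * φ z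
    with hψ
  have hsub : smoothShadow K Φ ⊆ shadow K Φ := fun y hy => hy.1
  have hm := measurableSet_smoothShadow K Φ
  have hcont := (continuousOn_topPoint K Φ).mono hsub
  have himg : MeasurableSet (topPoint K Φ '' smoothShadow K Φ) :=
    hm.image_of_continuousOn_injOn hcont (injective_topPoint K Φ).injOn
  have hnull : μHE[m] (topPoint K Φ '' (shadow K Φ \ smoothShadow K Φ)) = 0 :=
    euclideanHausdorffMeasure_topPoint_image_eq_zero K Φ sdiff_subset
      (volume_shadow_diff_smoothShadow K Φ)
  -- Outside this image `ψ` vanishes, except on the null set of top points over nonsmooth points of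
  -- the shadow.
  have h1 : ∫⁻ z, ψ z ∂μHE[m] = ∫⁻ z in topPoint K Φ '' smoothShadow K Φ, ψ z ∂μHE[m] := by
    rw [← lintegral_indicator himg]
    refine lintegral_congr_ae ?_
    filter_upwards [measure_eq_zero_iff_ae_notMem.mp hnull] with z hz
    by_cases hzi : z ∈ topPoint K Φ '' smoothShadow K Φ
    · rw [indicator_of_mem hzi]
    · rw [indicator_of_notMem hzi]
      have : ¬ 0 < (inner ℝ Φ.w (gaussVec K z) : ℝ) := by
        intro hpos
        obtain ⟨y, hy, rfl⟩ := exists_topPoint_eq_of_inner_pos Φ hK hpos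
        by_cases hys : y ∈ smoothShadow K Φ
        · exact hzi ⟨y, hys, rfl⟩
        · exact hz ⟨y, ⟨hy, hys⟩, rfl⟩
      simp only [hψ]
      rw [ENNReal.ofReal_of_nonpos (not_lt.mp this), zero_mul]
  have h2 := lintegral_image_euclideanHausdorffMeasure hm
    (f := topPoint K Φ) (f' := fun y => Φ.graphDeriv (fderiv ℝ (top K Φ) y))
    (fun y hy => (Φ.hasFDerivAt_graph hy.2.hasFDerivAt).hasFDerivWithinAt)
    (injective_topPoint K Φ).injOn
    (fun y _ v => by rw [Φ.graphDeriv_apply]; exact Φ.norm_le_norm_point _ _)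
    (by
      simp only [Φ.normDet_graphDeriv]
      have := measurable_fderiv ℝ (top K Φ)
      fun_prop) ψ
  rw [finrank_euclideanSpace_fin] at h2
  rw [h1, h2]
  -- The Jacobian of the graph and the factor `w · ν_K` cancel.
  have h3 : ∫⁻ y in smoothShadow K Φ, ENNReal.ofReal
      (Φ.graphDeriv (fderiv ℝ (top K Φ) y) : Space m →ₗ[ℝ] Space (m + 1)).normDet *
        ψ (topPoint K Φ y) = ∫⁻ y in smoothShadow K Φ, φ (topPoint K Φ y) := by
    refine setLIntegral_congr_fun hm fun y hy => ?_
    simp only [hψ]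
    rw [Φ.normDet_graphDeriv, inner_gaussVec_topPoint Φ hK hy, ← mul_assoc,
      ← ENNReal.ofReal_mul (by positivity), mul_inv_cancel₀ (by positivity), ENNReal.ofReal_one,
      one_mul]
  rw [h3]
  refine setLIntegral_congr ?_
  exact (LE.le.eventuallyLE hsub).antisymm
    (ae_le_set.mpr (volume_shadow_diff_smoothShadow K Φ))

end Normals

/-! ### Chords from a point and directions into the interior. -/

section RadialFunction

open Filter Topology

variable {n : ℕ} {K : ConvexBody (Space n)} {z : Space n}

theorem isCompact_chord (K : ConvexBody (Space n)) (z : Space n) (u : Sphere n) :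
    IsCompact {t : ℝ | z + t • (u : Space n) ∈ K} := by
  refine isCompact_of_isClosed_isBounded ?_ ?_
  · exact K.isClosed.preimage (f := fun t : ℝ => z + t • (u : Space n)) (by fun_prop)
  · obtain ⟨C, hC⟩ := K.isBounded.exists_norm_le
    refine isBounded_iff_forall_norm_le.mpr ⟨C + ‖z‖, fun t ht => ?_⟩
    have h1 := hC _ ht
    have h2 := norm_sub_le (z + t • (u : Space n)) z
    rw [add_sub_cancel_left, norm_smul, mem_sphere_zero_iff_norm.mp u.2, mul_one] at h2
    linarith

theorem add_radialFunction_smul_mem (hz : z ∈ K) (u : Sphere n) :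
    z + radialFunction K z u • (u : Space n) ∈ K :=
  (isCompact_chord K z u).sSup_mem ⟨0, by simpa using hz⟩

theorem le_radialFunction {u : Sphere n} {t : ℝ} (h : z + t • (u : Space n) ∈ K) :
    t ≤ radialFunction K z u :=
  le_csSup (isCompact_chord K z u).bddAbove h

theorem radialFunction_nonneg (hz : z ∈ K) (u : Sphere n) : 0 ≤ radialFunction K z u :=
  le_radialFunction (by simpa using hz)

/-- Positive superlevel sets of the radial function become closed conditions, from which its
measurability follows. For `t < 0` the equivalence can fail, the left side being always true. -/
theorem le_radialFunction_iff (hz : z ∈ K) {u : Sphere n} {t : ℝ} (ht : 0 < t) :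
    t ≤ radialFunction K z u ↔ z + t • (u : Space n) ∈ K := by
  refine ⟨fun h => ?_, le_radialFunction⟩
  have hr : 0 < radialFunction K z u := ht.trans_le h
  have := K.convex.add_smul_mem hz (add_radialFunction_smul_mem hz u)
    (t := t / radialFunction K z u) ⟨by positivity, (div_le_one hr).mpr h⟩
  rwa [smul_smul, div_mul_cancel₀ _ hr.ne'] at this

theorem exists_radialFunction_le (K : ConvexBody (Space n)) :
    ∃ C : ℝ, 0 < C ∧ ∀ z ∈ K, ∀ u : Sphere n, radialFunction K z u ≤ C := by
  obtain ⟨C, hC⟩ := K.isBounded.exists_norm_le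
  refine ⟨2 * |C| + 1, by positivity, fun z hz u => ?_⟩
  have h1 := hC _ (add_radialFunction_smul_mem hz u)
  have h3 := hC _ hz
  have h2 := norm_sub_le (z + radialFunction K z u • (u : Space n)) z
  rw [add_sub_cancel_left, norm_smul, mem_sphere_zero_iff_norm.mp u.2, mul_one,
    Real.norm_eq_abs] at h2
  have := le_abs_self C
  have := le_abs_self (radialFunction K z u)
  linarith

/-- The directions that point from `z` into the interior of `K`. -/
def innerCone (K : ConvexBody (Space n)) (z : Space n) : Set (Space n) :=
  {v | ∃ s : ℝ, 0 < s ∧ z + s • v ∈ interior (K : Set (Space n))}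

theorem isOpen_innerCone (K : ConvexBody (Space n)) (z : Space n) : IsOpen (innerCone K z) := by
  have : innerCone K z = ⋃ s ∈ Ioi (0 : ℝ), (fun v => z + s • v) ⁻¹' interior (K : Set (Space n)) := by
    ext v; simp [innerCone]
  rw [this]
  exact isOpen_biUnion fun s _ => isOpen_interior.preimage (by fun_prop)

theorem convex_innerCone (K : ConvexBody (Space n)) (z : Space n) : Convex ℝ (innerCone K z) := by
  rintro v₁ ⟨s₁, h₁, hv₁⟩ v₂ ⟨s₂, h₂, hv₂⟩ a b ha hb hab
  have hpos : 0 < a / s₁ + b / s₂ := by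
    rcases ha.eq_or_lt with rfl | ha'
    · rw [zero_add] at hab
      subst hab
      positivity
    · positivity
  -- This scale `s` makes the weights `s a / s₁` and `s b / s₂` of the two interior points add up to
  -- `1`.
  refine ⟨(a / s₁ + b / s₂)⁻¹, by positivity, ?_⟩
  have := K.convex.interior hv₁ hv₂ (a := (a / s₁ + b / s₂)⁻¹ * (a / s₁))
    (b := (a / s₁ + b / s₂)⁻¹ * (b / s₂)) (by positivity) (by positivity)
    (by rw [← mul_add, inv_mul_cancel₀ hpos.ne'])
  convert this using 1
  have e0 : (a / s₁ + b / s₂)⁻¹ * (a / s₁) + (a / s₁ + b / s₂)⁻¹ * (b / s₂) = 1 := by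
    rw [← mul_add, inv_mul_cancel₀ hpos.ne']
  have e1 : (a / s₁ + b / s₂)⁻¹ * (a / s₁) * s₁ = (a / s₁ + b / s₂)⁻¹ * a := by field_simp
  have e2 : (a / s₁ + b / s₂)⁻¹ * (b / s₂) * s₂ = (a / s₁ + b / s₂)⁻¹ * b := by field_simp
  rw [smul_add, smul_add, smul_add, smul_smul, smul_smul, smul_smul, smul_smul, e1, e2,
    add_add_add_comm, ← add_smul, e0, one_smul]

theorem smul_mem_innerCone_iff {v : Space n} {r : ℝ} (hr : 0 < r) :
    r • v ∈ innerCone K z ↔ v ∈ innerCone K z := by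
  constructor
  · rintro ⟨s, hs, h⟩
    exact ⟨s * r, by positivity, by rwa [mul_smul]⟩
  · rintro ⟨s, hs, h⟩
    exact ⟨s / r, by positivity, by rwa [smul_smul, div_mul_cancel₀ _ hr.ne']⟩

theorem smul_mem_closure_innerCone {v : Space n} {r : ℝ} (hr : 0 < r)
    (hv : v ∈ closure (innerCone K z)) : r • v ∈ closure (innerCone K z) :=
  map_mem_closure (f := fun v => r • v) (by fun_prop) hv
    fun _ hu => (smul_mem_innerCone_iff hr).mpr hu

theorem mem_closure_innerCone (hK : (interior (K : Set (Space n))).Nonempty) {v : Space n} {s : ℝ}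
    (hs : 0 < s) (h : z + s • v ∈ K) : v ∈ closure (innerCone K z) := by
  have hx : z + s • v ∈ closure (interior (K : Set (Space n))) := by
    rw [K.convex.closure_interior_eq_closure_of_nonempty_interior hK]
    exact subset_closure h
  have := map_mem_closure (f := fun p => s⁻¹ • (p - z)) (t := innerCone K z) (by fun_prop) hx
    fun p hp => ⟨s, hs, by rwa [smul_smul, mul_inv_cancel₀ hs.ne', one_smul, add_sub_cancel]⟩
  simpa [smul_smul, inv_mul_cancel₀ hs.ne'] using this

/-- Spherical Lebesgue measure. -/
abbrev sphereMeasure (n : ℕ) : Measure (Sphere n) := (volume : Measure (Space n)).toSphere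

/-- The exceptional directions span rays in the frontier of an open convex cone, and the frontier of
a convex set is Lebesgue null. -/
theorem sphereMeasure_frontier_innerCone (K : ConvexBody (Space n)) (z : Space n) :
    sphereMeasure n {u | (u : Space n) ∈ closure (innerCone K z) \ innerCone K z} = 0 := by
  have hm : MeasurableSet {u : Sphere n | (u : Space n) ∈ closure (innerCone K z) \ innerCone K z} :=
    (isClosed_closure.measurableSet.diff (isOpen_innerCone K z).measurableSet).preimage
      measurable_subtype_coe
  rw [Measure.toSphere_apply' _ hm]
  refine mul_eq_zero_of_right _ (measure_mono_null ?_
    ((convex_innerCone K z).addHaar_frontier volume))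
  rintro _ ⟨r, ⟨hr, -⟩, _, ⟨u, ⟨hu, hu'⟩, rfl⟩, rfl⟩
  rw [(isOpen_innerCone K z).frontier_eq]
  exact ⟨smul_mem_closure_innerCone hr hu, fun h => hu' ((smul_mem_innerCone_iff hr).mp h)⟩

/-- One interior point on the chord makes the whole open chord interior: the point in question lies
between it and one of the two ends. -/
theorem add_smul_mem_interior {u : Sphere n} (hz : z ∈ K) (hu : (u : Space n) ∈ innerCone K z) {x : ℝ}
    (hx : 0 < x) (hxr : x < radialFunction K z u) :
    z + x • (u : Space n) ∈ interior (K : Set (Space n)) := by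
  obtain ⟨s, hs, h⟩ := hu
  rcases lt_trichotomy x s with hlt | rfl | hlt
  · have := K.convex.combo_interior_self_mem_interior h hz (a := x / s) (b := 1 - x / s)
      (by positivity) (by rw [sub_nonneg, div_le_one hs]; exact hlt.le) (by ring)
    convert this using 1
    rw [smul_add, smul_smul, div_mul_cancel₀ _ hs.ne', sub_smul, one_smul]
    abel
  · exact h
  · have hr := add_radialFunction_smul_mem hz u
    set r := radialFunction K z u
    have hrs : 0 < r - s := by linarith
    have := K.convex.combo_interior_self_mem_interior h hr (a := (r - x) / (r - s))
      (b := (x - s) / (r - s)) (div_pos (by linarith) hrs) (div_nonneg (by linarith) hrs.le)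
      (by field_simp; ring)
    convert this using 1
    have e1 : (r - x) / (r - s) + (x - s) / (r - s) = 1 := by field_simp; ring
    have e2 : (r - x) / (r - s) * s + (x - s) / (r - s) * r = x := by field_simp; ring
    rw [smul_add, smul_add, smul_smul, smul_smul, add_add_add_comm, ← add_smul, ← add_smul, e1, e2,
      one_smul]

/-- For almost every direction, the ray from `z` meets the interior of `K` if it meets `K` outside
`z`. -/
theorem sphereMeasure_lt_radialFunction_diff (hK : (interior (K : Set (Space n))).Nonempty)
    (hz : z ∈ K) {x : ℝ} (hx : 0 < x) :
    sphereMeasure n {u | x < radialFunction K z u ∧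
      z + x • (u : Space n) ∉ interior (K : Set (Space n))} = 0 := by
  refine measure_mono_null ?_ (sphereMeasure_frontier_innerCone K z)
  rintro u ⟨hu, hni⟩
  exact ⟨mem_closure_innerCone hK (hx.trans hu) (add_radialFunction_smul_mem hz u),
    fun h => hni (add_smul_mem_interior hz h hx hu)⟩

theorem measurePreserving_neg_sphereMeasure (n : ℕ) :
    MeasurePreserving (fun u : Sphere n => -u) (sphereMeasure n) (sphereMeasure n) := by
  have hm : Measurable fun u : Sphere n => -u := continuous_neg.measurable
  refine ⟨hm, ?_⟩
  ext A hA
  rw [Measure.map_apply hm hA, Measure.toSphere_apply' _ hA, Measure.toSphere_apply' _ (hm hA)]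
  congr 1
  rw [← Measure.measure_preimage_neg (volume : Measure (Space n))]
  congr 1
  ext v
  rw [Set.mem_preimage, Set.mem_smul, Set.mem_smul]
  constructor
  · rintro ⟨r, hr, _, ⟨u, hu, rfl⟩, h⟩
    refine ⟨r, hr, _, ⟨-u, hu, rfl⟩, ?_⟩
    rw [coe_neg_sphere, smul_neg, h, neg_neg]
  · rintro ⟨r, hr, _, ⟨u, hu, rfl⟩, h⟩
    refine ⟨r, hr, _, ⟨-u, by simpa using hu, rfl⟩, ?_⟩
    rw [coe_neg_sphere, smul_neg, h]

end RadialFunction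

/-! ### The projection of the overlap of a body with its translate. -/

section ShiftedShadow

open Filter Topology

variable {m : ℕ} (K : ConvexBody (Space (m + 1))) (Φ : Frame m)

/-- The projection of `K ∩ (K - x u)`. -/
def overlapShadow (x : ℝ) (u : Sphere (m + 1)) : Set (Space m) :=
  Φ.proj '' {k | k ∈ K ∧ k + x • (u : Space (m + 1)) ∈ K}

/-- The base points of the top points that stay in `K` when shifted by `x u`. -/
def shiftMem (x : ℝ) (u : Sphere (m + 1)) : Set (Space m) :=
  {y | y ∈ shadow K Φ ∧ topPoint K Φ y + x • (u : Space (m + 1)) ∈ K}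

/-- The base points of the top points that get into the interior of `K` when shifted by `x u`. -/
def shiftMemInterior (x : ℝ) (u : Sphere (m + 1)) : Set (Space m) :=
  {y | y ∈ shadow K Φ ∧
    topPoint K Φ y + x • (u : Space (m + 1)) ∈ interior (K : Set (Space (m + 1)))}

theorem continuousOn_topPoint_add (x : ℝ) : ContinuousOn
    (fun p : Space m × Sphere (m + 1) => topPoint K Φ p.1 + x • (p.2 : Space (m + 1)))
    (shadow K Φ ×ˢ univ) := by
  refine ContinuousOn.add ?_ (by fun_prop)
  exact (continuousOn_topPoint K Φ).comp continuousOn_fst fun p hp => hp.1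

theorem measurableSet_prod_shiftMem (x : ℝ) :
    MeasurableSet {p : Space m × Sphere (m + 1) | p.1 ∈ shiftMem K Φ x p.2} := by
  have h := (continuousOn_topPoint_add K Φ x).isOpen_inter_preimage
    ((isOpen_shadow K Φ).prod isOpen_univ) K.isClosed.isOpen_compl
  have : {p : Space m × Sphere (m + 1) | p.1 ∈ shiftMem K Φ x p.2} = (shadow K Φ ×ˢ univ) \
      ((shadow K Φ ×ˢ univ) ∩ (fun p : Space m × Sphere (m + 1) =>
        topPoint K Φ p.1 + x • (p.2 : Space (m + 1))) ⁻¹' (K : Set (Space (m + 1)))ᶜ) := by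
    ext p
    simp [shiftMem]
  rw [this]
  exact ((isOpen_shadow K Φ).prod isOpen_univ).measurableSet.diff h.measurableSet

theorem isOpen_prod_shiftMemInterior (x : ℝ) :
    IsOpen {p : Space m × Sphere (m + 1) | p.1 ∈ shiftMemInterior K Φ x p.2} := by
  have h := (continuousOn_topPoint_add K Φ x).isOpen_inter_preimage
    ((isOpen_shadow K Φ).prod isOpen_univ) (isOpen_interior (s := (K : Set (Space (m + 1)))))
  convert h using 1
  ext p
  simp [shiftMemInterior]

variable {K}

theorem point_mem_of_le_of_le {y : Space m} {a b s : ℝ} (ha : Φ.point y a ∈ K)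
    (hb : Φ.point y b ∈ K) (h1 : a ≤ s) (h2 : s ≤ b) : Φ.point y s ∈ K := by
  have hconv : Convex ℝ {s | Φ.point y s ∈ K} := by
    intro p hp q hq c d hc hd hcd
    have := K.convex hp hq hc hd hcd
    rwa [← Φ.point_smul, ← Φ.point_smul, ← Φ.point_add, ← add_smul, hcd, one_smul] at this
  exact hconv.ordConnected.out ha hb ⟨h1, h2⟩

theorem add_smul_eq_point (z : Space (m + 1)) (x : ℝ) (u : Space (m + 1)) :
    z + x • u = Φ.point (Φ.proj z + x • Φ.proj u) (inner ℝ Φ.w z + x * inner ℝ Φ.w u) := by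
  rw [Φ.point_add, Φ.point_smul, Φ.point_proj, Φ.point_proj]

theorem point_add_smul (y : Space m) (s x : ℝ) (u : Space (m + 1)) :
    Φ.point y s + x • u = Φ.point (y + x • Φ.proj u) (s + x * inner ℝ Φ.w u) := by
  rw [add_smul_eq_point Φ, Φ.proj_point, Φ.inner_w_point]

theorem volume_image_proj_diff_shadow (hK : (interior (K : Set (Space (m + 1)))).Nonempty) :
    volume (Φ.proj '' (K : Set (Space (m + 1))) \ shadow K Φ) = 0 := by
  refine measure_mono_null ?_ ((convex_shadow K Φ).addHaar_frontier volume)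
  rw [(isOpen_shadow K Φ).frontier_eq]
  refine sdiff_subset_sdiff_left ?_
  rintro _ ⟨x, hx, rfl⟩
  have hx' : x ∈ closure (interior (K : Set (Space (m + 1)))) := by
    rw [K.convex.closure_interior_eq_closure_of_nonempty_interior hK]
    exact subset_closure hx
  exact map_mem_closure Φ.proj.continuous hx' fun y hy => mem_image_of_mem _ hy

/-- Over a point `y` of the overlap, the lower of the tops of `K` and `K - xu` lies in both bodies.
It is the top point of `K` over `y`, or the top point over `y + d` moved back by `xu`; translation
by `d` preserves volume. -/
theorem volume_overlapShadow_le (hK : (interior (K : Set (Space (m + 1)))).Nonempty) (x : ℝ)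
    (u : Sphere (m + 1)) : volume (overlapShadow K Φ x u) ≤
      volume (shiftMem K Φ x u) + volume (shiftMem K Φ x (-u)) := by
  set N := Φ.proj '' (K : Set (Space (m + 1))) \ shadow K Φ
  have hN : volume N = 0 := volume_image_proj_diff_shadow Φ hK
  set d := x • Φ.proj (u : Space (m + 1)) with hd
  have hsub : overlapShadow K Φ x u ⊆
      (shiftMem K Φ x u ∪ (fun y => y + d) ⁻¹' shiftMem K Φ x (-u)) ∪
        (N ∪ (fun y => y + d) ⁻¹' N) := by
    rintro _ ⟨k, ⟨hk, hku⟩, rfl⟩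
    have hp1 : Φ.proj k ∈ Φ.proj '' (K : Set (Space (m + 1))) := mem_image_of_mem _ hk
    have hp2 : Φ.proj k + d ∈ Φ.proj '' (K : Set (Space (m + 1))) :=
      ⟨_, hku, by rw [map_add, map_smul]⟩
    by_cases h1 : Φ.proj k ∈ shadow K Φ
    swap
    · exact Or.inr (Or.inl ⟨hp1, h1⟩)
    by_cases h2 : Φ.proj k + d ∈ shadow K Φ
    swap
    · exact Or.inr (Or.inr ⟨hp2, h2⟩)
    left
    have hk' := hk
    rw [← Φ.point_proj k] at hk
    rw [add_smul_eq_point Φ, ← hd] at hku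
    have ht1 := topPoint_mem_of_mem_shadow Φ h1
    have ht2 := topPoint_mem_of_mem_shadow Φ h2
    have hl1 := le_top Φ hk
    have hl2 := le_top Φ hku
    -- The two tops are compared after moving both by `xu`, so over `proj k + d`.
    rcases le_total (top K Φ (Φ.proj k) + x * inner ℝ Φ.w (u : Space (m + 1)))
      (top K Φ (Φ.proj k + d)) with h | h
    · left
      refine ⟨h1, ?_⟩
      rw [topPoint, point_add_smul, ← hd]
      exact point_mem_of_le_of_le Φ hku ht2 (by linarith) h
    · right
      refine ⟨h2, ?_⟩
      rw [topPoint, coe_neg_sphere, point_add_smul]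
      have : Φ.proj k + d + x • Φ.proj (-(u : Space (m + 1))) = Φ.proj k := by
        rw [map_neg, smul_neg, ← hd, add_neg_cancel_right]
      rw [this, inner_neg_right]
      exact point_mem_of_le_of_le Φ hk ht1 (by linarith) (by linarith)
  refine (measure_mono hsub).trans ((measure_union_le _ _).trans ?_)
  rw [measure_union_null hN (by rw [measure_preimage_add_right, hN]), add_zero]
  refine (measure_union_le _ _).trans ?_
  rw [measure_preimage_add_right]

/-- Landing in the interior means landing strictly below the top, so the two cases exclude each
other. With `shiftMem` instead, equal tops would be counted twice. -/
theorem le_volume_overlapShadow (x : ℝ) (u : Sphere (m + 1)) :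
    volume (shiftMemInterior K Φ x u) + volume (shiftMemInterior K Φ x (-u)) ≤
      volume (overlapShadow K Φ x u) := by
  set d := x • Φ.proj (u : Space (m + 1)) with hd
  have hm : MeasurableSet (shiftMemInterior K Φ x u) :=
    ((isOpen_prod_shiftMemInterior K Φ x).preimage
      (f := fun y : Space m => (y, u)) (by fun_prop)).measurableSet
  have hback : ∀ y, y + d + x • Φ.proj (-(u : Space (m + 1))) = y := fun y => by
    rw [map_neg, smul_neg, ← hd, add_neg_cancel_right]
  rw [← measure_preimage_add_right volume d (shiftMemInterior K Φ x (-u)),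
    ← measure_union' _ hm]
  · refine measure_mono ?_
    rintro y (⟨hy, hyu⟩ | ⟨hy, hyu⟩)
    · exact ⟨_, ⟨topPoint_mem_of_mem_shadow Φ hy, interior_subset hyu⟩, proj_topPoint K Φ y⟩
    · refine ⟨_, ⟨interior_subset hyu, ?_⟩, ?_⟩
      · rw [coe_neg_sphere, smul_neg, neg_add_cancel_right]
        exact topPoint_mem_of_mem_shadow Φ hy
      · rw [coe_neg_sphere, topPoint, point_add_smul, Φ.proj_point, hback]
  · refine disjoint_left.mpr ?_
    rintro y ⟨hy, hyu⟩ ⟨hy', hyu'⟩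
    rw [topPoint, point_add_smul, ← hd] at hyu
    rw [topPoint, coe_neg_sphere, point_add_smul, hback, inner_neg_right] at hyu'
    have h1 := lt_top_of_mem_interior Φ hyu
    have h2 := lt_top_of_mem_interior Φ hyu'
    linarith

/-- With `τ = x / r`, the point `(1 - τ) k + τ c` lies in `K`, and adding `xu` gives `(1 - τ) k + τ
(c + ru)`, which lies in `K` too. -/
theorem le_volume_overlapShadow_of_closedBall {c : Space (m + 1)} {r : ℝ}
    (hr : 0 < r) (hc : closedBall c r ⊆ (K : Set (Space (m + 1)))) {x : ℝ} (hx : 0 < x)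
    (hxr : x ≤ r) (u : Sphere (m + 1)) :
    ENNReal.ofReal ((1 - x / r) ^ m) * volume (Φ.proj '' (K : Set (Space (m + 1)))) ≤
      volume (overlapShadow K Φ x u) := by
  have hτ : x / r ≤ 1 := (div_le_one hr).mpr hxr
  have hcK : c ∈ K := hc (mem_closedBall_self hr.le)
  have hsub : (fun y => (1 - x / r) • y + (x / r) • Φ.proj c) ''
      (Φ.proj '' (K : Set (Space (m + 1)))) ⊆ overlapShadow K Φ x u := by
    rintro _ ⟨_, ⟨k, hk, rfl⟩, rfl⟩
    refine ⟨(1 - x / r) • k + (x / r) • c, ⟨?_, ?_⟩, by simp⟩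
    · exact K.convex hk hcK (by linarith) (by positivity) (by ring)
    · have hcr : c + r • (u : Space (m + 1)) ∈ K := by
        apply hc
        rw [mem_closedBall, dist_eq_norm, add_sub_cancel_left, norm_smul,
          mem_sphere_zero_iff_norm.mp u.2, mul_one, Real.norm_of_nonneg hr.le]
      have := K.convex hk hcr (a := 1 - x / r) (b := x / r) (by linarith) (by positivity) (by ring)
      rwa [smul_add, smul_smul, div_mul_cancel₀ _ hr.ne', ← add_assoc] at this
  refine le_trans (le_of_eq ?_) (measure_mono hsub)
  have himg : (fun y => (1 - x / r) • y + (x / r) • Φ.proj c) ''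
      (Φ.proj '' (K : Set (Space (m + 1)))) = (fun y => y + (x / r) • Φ.proj c) ''
        ((fun y => (1 - x / r) • y) '' (Φ.proj '' (K : Set (Space (m + 1))))) := by
    rw [image_image (f := fun y : Space m => (1 - x / r) • y)]
  rw [himg, image_add_right, measure_preimage_add_right, image_smul, Measure.addHaar_smul,
    finrank_euclideanSpace_fin, abs_of_nonneg (pow_nonneg (by linarith) _)]

end ShiftedShadow

/-! ### The distribution of chord lengths and its symmetry. -/

section ChordLengths

open Filter Topology

variable {m : ℕ} (K : ConvexBody (Space (m + 1))) (Φ : Frame m)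

/-- The length of the chord from the top point above `y` in the direction `u`. -/
def topRadial (p : Space m × Sphere (m + 1)) : ℝ :=
  open Classical in
  if p.1 ∈ shadow K Φ then radialFunction K (topPoint K Φ p.1) p.2 else 0

variable {K} in
theorem topRadial_of_mem {y : Space m} (hy : y ∈ shadow K Φ) (u : Sphere (m + 1)) :
    topRadial K Φ (y, u) = radialFunction K (topPoint K Φ y) u := by
  simp [topRadial, hy]

variable {K} in
theorem topRadial_of_notMem {y : Space m} (hy : y ∉ shadow K Φ) (u : Sphere (m + 1)) :
    topRadial K Φ (y, u) = 0 := by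
  simp [topRadial, hy]

theorem topRadial_nonneg (p : Space m × Sphere (m + 1)) : 0 ≤ topRadial K Φ p := by
  unfold topRadial
  split_ifs with h
  · exact radialFunction_nonneg (topPoint_mem_of_mem_shadow Φ h) _
  · exact le_rfl

theorem le_topRadial_iff {x : ℝ} (hx : 0 < x) (p : Space m × Sphere (m + 1)) :
    x ≤ topRadial K Φ p ↔ p.1 ∈ shiftMem K Φ x p.2 := by
  by_cases h : p.1 ∈ shadow K Φ
  · rw [show p = (p.1, p.2) from rfl, topRadial_of_mem Φ h,
      le_radialFunction_iff (topPoint_mem_of_mem_shadow Φ h) hx]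
    simp [shiftMem, h]
  · rw [show p = (p.1, p.2) from rfl, topRadial_of_notMem Φ h]
    simp [shiftMem, h, hx]

theorem measurable_topRadial : Measurable (topRadial K Φ) := by
  refine measurable_of_Ici fun x => ?_
  rcases le_or_gt x 0 with hx | hx
  · convert MeasurableSet.univ
    exact eq_univ_of_forall fun p => hx.trans (topRadial_nonneg K Φ p)
  · convert measurableSet_prod_shiftMem K Φ x using 1
    ext p
    exact le_topRadial_iff K Φ hx p

/-- The distribution of the lengths of the chords from the top points. -/
def chordLengths : Measure ℝ :=
  (((volume : Measure (Space m)).prod (sphereMeasure (m + 1))).map (topRadial K Φ)).restrict (Ioi 0)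

theorem chordLengths_apply {A : Set ℝ} (hA : MeasurableSet A) (hA0 : A ⊆ Ioi 0) :
    chordLengths K Φ A = ((volume : Measure (Space m)).prod (sphereMeasure (m + 1)))
      (topRadial K Φ ⁻¹' A) := by
  rw [chordLengths, Measure.restrict_apply hA, inter_eq_left.mpr hA0,
    Measure.map_apply (measurable_topRadial K Φ) hA]

theorem chordLengths_inter (A : Set ℝ) (hA : MeasurableSet A) :
    chordLengths K Φ A = chordLengths K Φ (A ∩ Ioi 0) := by
  rw [chordLengths, Measure.restrict_apply hA, Measure.restrict_apply (hA.inter measurableSet_Ioi),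
    inter_assoc, inter_self]

/-- The mean measure of the projections of the intersections `K ∩ (K - x u)`. -/
def meanOverlap (x : ℝ) : ℝ≥0∞ := ∫⁻ u, volume (overlapShadow K Φ x u) ∂sphereMeasure (m + 1)

/-- The overlap involves the projection only, never the direction `w`. This is the source of the
symmetry between the upper and the lower boundary. -/
theorem meanOverlap_neg (x : ℝ) : meanOverlap K Φ.neg x = meanOverlap K Φ x := rfl

variable {K}

/-- The terms for `u` and `-u` have the same integral over the sphere, whence the factor `2`, here
and in the opposite bound `le_meanOverlap`. -/
theorem meanOverlap_le (hK : (interior (K : Set (Space (m + 1)))).Nonempty) {x : ℝ} (hx : 0 < x) :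
    meanOverlap K Φ x ≤ 2 * chordLengths K Φ (Ici x) := by
  have hm := measurableSet_prod_shiftMem K Φ x
  have hmv : Measurable fun u => volume (shiftMem K Φ x u) := measurable_measure_prodMk_right hm
  have h1 : chordLengths K Φ (Ici x) =
      ∫⁻ u, volume (shiftMem K Φ x u) ∂sphereMeasure (m + 1) := by
    rw [chordLengths_apply K Φ measurableSet_Ici fun y hy => hx.trans_le hy,
      show topRadial K Φ ⁻¹' Ici x = {p | p.1 ∈ shiftMem K Φ x p.2} from
        ext fun p => le_topRadial_iff K Φ hx p, Measure.prod_apply_symm hm]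
    rfl
  have h2 : ∫⁻ u, volume (shiftMem K Φ x (-u)) ∂sphereMeasure (m + 1) =
      ∫⁻ u, volume (shiftMem K Φ x u) ∂sphereMeasure (m + 1) :=
    (measurePreserving_neg_sphereMeasure (m + 1)).lintegral_comp hmv
  calc meanOverlap K Φ x ≤ ∫⁻ u, (volume (shiftMem K Φ x u) + volume (shiftMem K Φ x (-u)))
        ∂sphereMeasure (m + 1) := lintegral_mono fun u => volume_overlapShadow_le Φ hK x u
    _ = 2 * chordLengths K Φ (Ici x) := by
      rw [lintegral_add_left hmv, h2, h1, two_mul]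

theorem le_meanOverlap (hK : (interior (K : Set (Space (m + 1)))).Nonempty) {x : ℝ} (hx : 0 < x) :
    2 * chordLengths K Φ (Ioi x) ≤ meanOverlap K Φ x := by
  have hm := (isOpen_prod_shiftMemInterior K Φ x).measurableSet
  have hmv : Measurable fun u => volume (shiftMemInterior K Φ x u) :=
    measurable_measure_prodMk_right hm
  have hml : MeasurableSet (topRadial K Φ ⁻¹' Ioi x) := measurable_topRadial K Φ measurableSet_Ioi
  -- For each base point, almost every direction whose chord is longer than `x` reaches the interior
  -- at distance `x`.
  have hnull : ((volume : Measure (Space m)).prod (sphereMeasure (m + 1)))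
      ((topRadial K Φ ⁻¹' Ioi x) \ {p | p.1 ∈ shiftMemInterior K Φ x p.2}) = 0 := by
    rw [Measure.measure_prod_null (hml.diff hm)]
    refine Eventually.of_forall fun y => ?_
    by_cases hy : y ∈ shadow K Φ
    · refine measure_mono_null ?_ (sphereMeasure_lt_radialFunction_diff hK
        (topPoint_mem_of_mem_shadow Φ hy) hx)
      rintro u ⟨hu, hu'⟩
      rw [mem_preimage, topRadial_of_mem Φ hy] at hu
      exact ⟨hu, fun h => hu' ⟨hy, h⟩⟩
    · have : Prod.mk y ⁻¹' ((topRadial K Φ ⁻¹' Ioi x) \ {p | p.1 ∈ shiftMemInterior K Φ x p.2}) =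
          ∅ := by
        refine eq_empty_of_forall_notMem fun u hu => ?_
        have := hu.1
        rw [mem_preimage, topRadial_of_notMem Φ hy] at this
        exact lt_irrefl _ (hx.trans this)
      simp only [this, measure_empty, Pi.zero_apply]
  have h1 : chordLengths K Φ (Ioi x) ≤
      ∫⁻ u, volume (shiftMemInterior K Φ x u) ∂sphereMeasure (m + 1) := by
    rw [chordLengths_apply K Φ measurableSet_Ioi fun y hy => hx.trans hy]
    refine (measure_mono_ae (ae_le_set.mpr hnull)).trans_eq ?_
    rw [Measure.prod_apply_symm hm]
    rfl
  have h2 : ∫⁻ u, volume (shiftMemInterior K Φ x (-u)) ∂sphereMeasure (m + 1) =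
      ∫⁻ u, volume (shiftMemInterior K Φ x u) ∂sphereMeasure (m + 1) :=
    (measurePreserving_neg_sphereMeasure (m + 1)).lintegral_comp hmv
  calc 2 * chordLengths K Φ (Ioi x)
      ≤ 2 * ∫⁻ u, volume (shiftMemInterior K Φ x u) ∂sphereMeasure (m + 1) := by gcongr
    _ = ∫⁻ u, (volume (shiftMemInterior K Φ x u) + volume (shiftMemInterior K Φ x (-u)))
          ∂sphereMeasure (m + 1) := by rw [lintegral_add_left hmv, h2, two_mul]
    _ ≤ meanOverlap K Φ x := lintegral_mono fun u => le_volume_overlapShadow Φ x u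

theorem tendsto_measure_Ioi (μ : Measure ℝ) (x : ℝ) :
    Tendsto (fun k : ℕ => μ (Ioi (x + 1 / ((k : ℝ) + 1)))) atTop (𝓝 (μ (Ioi x))) := by
  have hmono : Monotone fun k : ℕ => Ioi (x + 1 / ((k : ℝ) + 1)) := fun i j hij =>
    Ioi_subset_Ioi (by gcongr)
  have hU : Ioi x = ⋃ k : ℕ, Ioi (x + 1 / ((k : ℝ) + 1)) := by
    ext y
    simp only [mem_Ioi, mem_iUnion]
    constructor
    · intro h
      obtain ⟨k, hk⟩ := exists_nat_one_div_lt (sub_pos.mpr h)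
      exact ⟨k, by linarith⟩
    · rintro ⟨k, hk⟩
      have := Nat.one_div_pos_of_nat (α := ℝ) (n := k)
      linarith
  rw [hU]
  exact tendsto_measure_iUnion_atTop hmono

theorem chordLengths_Ioi_zero_le (hK : (interior (K : Set (Space (m + 1)))).Nonempty) :
    2 * chordLengths K Φ (Ioi 0) ≤
      sphereMeasure (m + 1) univ * volume (Φ.proj '' (K : Set (Space (m + 1)))) := by
  refine le_of_tendsto (ENNReal.Tendsto.const_mul (tendsto_measure_Ioi (chordLengths K Φ) 0)
    (Or.inr (by norm_num))) (Eventually.of_forall fun k => ?_)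
  have hk : (0 : ℝ) < 0 + 1 / ((k : ℝ) + 1) := by positivity
  refine (le_meanOverlap Φ hK hk).trans ?_
  rw [mul_comm, ← lintegral_const]
  exact lintegral_mono fun u => measure_mono (image_mono fun k hk => hk.1)

theorem volume_image_proj_lt_top :
    volume (Φ.proj '' (K : Set (Space (m + 1)))) < ∞ :=
  (K.isCompact.image Φ.proj.continuous).measure_lt_top

theorem isFiniteMeasure_chordLengths (hK : (interior (K : Set (Space (m + 1)))).Nonempty) :
    IsFiniteMeasure (chordLengths K Φ) := by
  refine ⟨?_⟩
  rw [chordLengths_inter K Φ _ MeasurableSet.univ, univ_inter]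
  have h := (chordLengths_Ioi_zero_le Φ hK).trans_lt
    (ENNReal.mul_lt_top (measure_lt_top _ _) (volume_image_proj_lt_top Φ))
  refine lt_of_le_of_lt ?_ h
  exact le_mul_of_one_le_left zero_le (by norm_num)

/-- The two bounds on `meanOverlap` differ by a possible atom (`Ioi` against `Ici`). Applying them
at `x + 1/(k+1)`, where `Ici` is contained in `Ioi x`, and letting `k → ∞` removes the gap. -/
theorem chordLengths_Ioi_le_neg (hK : (interior (K : Set (Space (m + 1)))).Nonempty) {x : ℝ}
    (hx : 0 ≤ x) : chordLengths K Φ (Ioi x) ≤ chordLengths K Φ.neg (Ioi x) := by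
  refine le_of_tendsto (tendsto_measure_Ioi (chordLengths K Φ) x) (Eventually.of_forall fun k => ?_)
  have hk : (0 : ℝ) < 1 / ((k : ℝ) + 1) := by positivity
  have hk' : 0 < x + 1 / ((k : ℝ) + 1) := by positivity
  have h := (le_meanOverlap Φ hK hk').trans
    ((meanOverlap_neg K Φ _).symm.le.trans (meanOverlap_le Φ.neg hK hk'))
  rw [ENNReal.mul_le_mul_iff_right (by norm_num) (by norm_num)] at h
  exact h.trans (measure_mono fun y hy => by
    rw [mem_Ici] at hy
    rw [mem_Ioi]
    linarith)

theorem Frame.neg_neg : Φ.neg.neg = Φ := by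
  cases Φ
  simp [Frame.neg]

/-- The chords from the upper and from the lower boundary have the same distribution of lengths. -/
theorem chordLengths_neg (hK : (interior (K : Set (Space (m + 1)))).Nonempty) :
    chordLengths K Φ.neg = chordLengths K Φ := by
  have heq : ∀ x : ℝ, 0 ≤ x → chordLengths K Φ.neg (Ioi x) = chordLengths K Φ (Ioi x) := by
    intro x hx
    refine le_antisymm ?_ (chordLengths_Ioi_le_neg Φ hK hx)
    have := chordLengths_Ioi_le_neg Φ.neg hK hx
    rwa [Frame.neg_neg] at this
  have heq' : ∀ x : ℝ, chordLengths K Φ.neg (Ioi x) = chordLengths K Φ (Ioi x) := by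
    intro x
    rw [chordLengths_inter K Φ _ measurableSet_Ioi, chordLengths_inter K Φ.neg _ measurableSet_Ioi,
      Ioi_inter_Ioi]
    exact heq _ (le_max_right _ _)
  have huniv : chordLengths K Φ.neg univ = chordLengths K Φ univ := by
    rw [chordLengths_inter K Φ _ MeasurableSet.univ, chordLengths_inter K Φ.neg _ MeasurableSet.univ,
      univ_inter]
    exact heq' 0
  have := isFiniteMeasure_chordLengths Φ hK
  have := isFiniteMeasure_chordLengths Φ.neg hK
  refine Measure.ext_of_Iic _ _ fun x => ?_
  rw [← compl_Ioi, measure_compl measurableSet_Ioi (measure_ne_top _ _),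
    measure_compl measurableSet_Ioi (measure_ne_top _ _), huniv, heq']

end ChordLengths

/-! ### Integrability of powers of the chord length. -/

section PowerIntegrals

/-- A finite measure on a bounded interval whose mass near zero is at most linear integrates all
powers with exponent greater than `-1`. -/
theorem lintegral_rpow_lt_top {μ : Measure ℝ} [IsFiniteMeasure μ] {C : ℝ≥0∞} (hC : C ≠ ∞)
    {r D q : ℝ} (hr : 0 < r) (hq : 0 < q) (hD : μ (Ioi D) = 0)
    (hμ : ∀ x, 0 < x → x ≤ r → μ (Ioo 0 x) ≤ C * ENNReal.ofReal x) :
    ∫⁻ x in Ioi 0, ENNReal.ofReal (x ^ (q - 1)) ∂μ < ∞ := by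
  -- Halving `r` puts the half-closed dyadic piece `I k` inside the open interval from `0` to `r
  -- (1/2)^k`.
  set s := r / 2 with hs
  have hs0 : 0 < s := by positivity
  let I : ℕ → Set ℝ := fun k => Ioc (s * (1 / 2) ^ (k + 1)) (s * (1 / 2) ^ k)
  have hsub : Ioi (0 : ℝ) ⊆ (Ioi D ∪ Icc s (max s D)) ∪ ⋃ k, I k := by
    intro x hx
    rw [mem_Ioi] at hx
    by_cases h1 : D < x
    · exact Or.inl (Or.inl h1)
    by_cases h2 : s ≤ x
    · exact Or.inl (Or.inr ⟨h2, (not_lt.mp h1).trans (le_max_right _ _)⟩)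
    · obtain ⟨k, hk1, hk2⟩ := exists_nat_pow_near_of_lt_one (x := x / s) (y := (1 / 2 : ℝ))
        (by positivity) ((div_le_one hs0).mpr (not_le.mp h2).le) (by norm_num) (by norm_num)
      refine Or.inr (mem_iUnion.mpr ⟨k, ?_, ?_⟩)
      · rw [lt_div_iff₀ hs0] at hk1
        linarith
      · rw [div_le_iff₀ hs0] at hk2
        linarith
  -- the powers are monotone up to a constant on intervals away from zero
  have hpow : ∀ a b x : ℝ, 0 < a → a ≤ x → x ≤ b → x ^ (q - 1) ≤ a ^ (q - 1) + b ^ (q - 1) := by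
    intro a b x ha hax hxb
    have hx : 0 < x := ha.trans_le hax
    rcases le_total 0 (q - 1) with h | h
    · have := Real.rpow_le_rpow hx.le hxb h
      have := Real.rpow_nonneg ha.le (q - 1)
      linarith
    · have := Real.rpow_le_rpow_of_nonpos ha hax h
      have := Real.rpow_nonneg (hx.le.trans hxb) (q - 1)
      linarith
  have hbd : ∀ a b : ℝ, ∀ S : Set ℝ, 0 < a → MeasurableSet S → (∀ x ∈ S, a ≤ x ∧ x ≤ b) →
      ∫⁻ x in S, ENNReal.ofReal (x ^ (q - 1)) ∂μ ≤
        ENNReal.ofReal (a ^ (q - 1) + b ^ (q - 1)) * μ S := by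
    intro a b S ha hS h
    rw [← setLIntegral_const]
    exact setLIntegral_mono' hS fun x hx =>
      ENNReal.ofReal_le_ofReal (hpow a b x ha (h x hx).1 (h x hx).2)
  have hA : ∫⁻ x in Ioi D, ENNReal.ofReal (x ^ (q - 1)) ∂μ = 0 :=
    setLIntegral_measure_zero _ _ hD
  have hB : ∫⁻ x in Icc s (max s D), ENNReal.ofReal (x ^ (q - 1)) ∂μ < ∞ :=
    (hbd s (max s D) _ hs0 measurableSet_Icc fun x hx => hx).trans_lt
      (ENNReal.mul_lt_top ENNReal.ofReal_lt_top (measure_lt_top _ _))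
  -- The power contributes `2^(-k(q-1))` and the mass `2^(-k)`: a geometric series of ratio `2^(-q)
  -- < 1`.
  have hI : ∀ k, ∫⁻ x in I k, ENNReal.ofReal (x ^ (q - 1)) ∂μ ≤
      C * ENNReal.ofReal (s ^ (q - 1) * ((1 / 2) ^ (q - 1) + 1) * r) *
        ENNReal.ofReal ((1 / 2) ^ q) ^ k := by
    intro k
    have hk : (0 : ℝ) < (1 / 2) ^ k := by positivity
    have hk1 : (1 / 2 : ℝ) ^ k ≤ 1 := pow_le_one₀ (by norm_num) (by norm_num)
    have h1 := hbd (s * (1 / 2) ^ (k + 1)) (s * (1 / 2) ^ k) (I k) (by positivity)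
      measurableSet_Ioc fun x hx => ⟨hx.1.le, hx.2⟩
    have h2 : μ (I k) ≤ C * ENNReal.ofReal (r * (1 / 2) ^ k) := by
      refine (measure_mono ?_).trans (hμ (r * (1 / 2) ^ k) (by positivity) (by nlinarith))
      intro x hx
      refine ⟨lt_trans (by positivity) hx.1, hx.2.trans_lt ?_⟩
      rw [hs]
      nlinarith
    refine h1.trans ((mul_le_mul_right h2 _).trans_eq ?_)
    rw [mul_left_comm, mul_assoc, ← ENNReal.ofReal_pow (by positivity),
      ← ENNReal.ofReal_mul (by positivity), ← ENNReal.ofReal_mul (by positivity)]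
    congr 2
    have e1 : (s * (1 / 2) ^ k) ^ (q - 1) = s ^ (q - 1) * ((1 / 2 : ℝ) ^ (q - 1)) ^ k := by
      rw [Real.mul_rpow hs0.le hk.le, ← Real.rpow_natCast, ← Real.rpow_natCast,
        ← Real.rpow_mul (by norm_num), ← Real.rpow_mul (by norm_num), mul_comm (q - 1)]
    have e2 : (s * (1 / 2) ^ (k + 1)) ^ (q - 1) =
        s ^ (q - 1) * ((1 / 2 : ℝ) ^ (q - 1)) ^ k * (1 / 2 : ℝ) ^ (q - 1) := by
      rw [pow_succ, ← mul_assoc, Real.mul_rpow (by positivity) (by norm_num), e1]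
    have e3 : ((1 / 2 : ℝ) ^ q) ^ k = ((1 / 2 : ℝ) ^ (q - 1)) ^ k * (1 / 2) ^ k := by
      rw [← mul_pow, ← Real.rpow_add_one (by norm_num), sub_add_cancel]
    rw [e1, e2, e3]
    ring
  have hsum : ∑' k : ℕ, C * ENNReal.ofReal (s ^ (q - 1) * ((1 / 2) ^ (q - 1) + 1) * r) *
      ENNReal.ofReal ((1 / 2) ^ q) ^ k < ∞ := by
    rw [ENNReal.tsum_mul_left, ENNReal.tsum_geometric]
    refine ENNReal.mul_lt_top (ENNReal.mul_lt_top hC.lt_top ENNReal.ofReal_lt_top) ?_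
    rw [ENNReal.inv_lt_top, tsub_pos_iff_lt, ENNReal.ofReal_lt_one]
    exact Real.rpow_lt_one (by norm_num) (by norm_num) hq
  refine (lintegral_mono_set hsub).trans_lt ?_
  refine (lintegral_union_le _ _ _).trans_lt (ENNReal.add_lt_top.mpr ⟨?_, ?_⟩)
  · refine (lintegral_union_le _ _ _).trans_lt (ENNReal.add_lt_top.mpr ⟨?_, hB⟩)
    rw [hA]
    exact ENNReal.zero_lt_top
  · exact (lintegral_iUnion_le _ _).trans_lt ((ENNReal.tsum_le_tsum hI).trans_lt hsum)

variable {m : ℕ} {K : ConvexBody (Space (m + 1))} (Φ : Frame m)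

/-- Twice the total mass is at most `T`, while twice the mass of `Ici x` is at least `T (1 -
x/r)^m`. Bernoulli's inequality bounds the difference linearly in `x`. -/
theorem exists_chordLengths_Ioo_le (hK : (interior (K : Set (Space (m + 1)))).Nonempty) :
    ∃ C : ℝ≥0∞, C ≠ ∞ ∧ ∃ r : ℝ, 0 < r ∧ ∀ x, 0 < x → x ≤ r →
      chordLengths K Φ (Ioo 0 x) ≤ C * ENNReal.ofReal x := by
  obtain ⟨c, hc⟩ := hK
  obtain ⟨r, hr, hball⟩ := nhds_basis_closedBall.mem_iff.mp (mem_interior_iff_mem_nhds.mp hc)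
  set T := sphereMeasure (m + 1) univ * volume (Φ.proj '' (K : Set (Space (m + 1)))) with hT
  have hTtop : T ≠ ∞ :=
    (ENNReal.mul_lt_top (measure_lt_top _ _) (volume_image_proj_lt_top Φ)).ne
  refine ⟨T * ENNReal.ofReal (m / r), ENNReal.mul_ne_top hTtop ENNReal.ofReal_ne_top, r, hr,
    fun x hx hxr => ?_⟩
  have hτ : x / r ≤ 1 := (div_le_one hr).mpr hxr
  set p := (1 - x / r) ^ m with hp
  have hp0 : 0 ≤ p := pow_nonneg (by linarith) _
  have hp1 : p ≤ 1 := pow_le_one₀ (by linarith) (by have : 0 < x / r := by positivity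
                                                    linarith)
  have hbern : 1 - p ≤ m / r * x := by
    have := one_add_mul_le_pow (a := -(x / r)) (by linarith) m
    rw [← sub_eq_add_neg, ← hp] at this
    have e : (m : ℝ) / r * x = m * (x / r) := by ring
    rw [e]
    linarith
  have h1 : T * ENNReal.ofReal p ≤ 2 * chordLengths K Φ (Ici x) := by
    refine le_trans ?_ (meanOverlap_le Φ ⟨c, hc⟩ hx)
    rw [hT, mul_assoc, mul_comm, mul_comm (volume _), ← lintegral_const]
    exact lintegral_mono fun u => le_volume_overlapShadow_of_closedBall Φ hr hball hx hxr u
  have h2 : chordLengths K Φ (Ioi 0) = chordLengths K Φ (Ioo 0 x) + chordLengths K Φ (Ici x) := by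
    rw [← measure_union _ measurableSet_Ici, Ioo_union_Ici_eq_Ioi hx]
    exact disjoint_left.mpr fun y hy hy' => absurd hy.2 (not_lt.mpr hy')
  have h3 := chordLengths_Ioi_zero_le Φ ⟨c, hc⟩
  rw [h2, mul_add, ← hT] at h3
  have h4 : T = T * ENNReal.ofReal (1 - p) + T * ENNReal.ofReal p := by
    rw [← mul_add, ← ENNReal.ofReal_add (by linarith) hp0, sub_add_cancel, ENNReal.ofReal_one,
      mul_one]
  have h5 : 2 * chordLengths K Φ (Ioo 0 x) + T * ENNReal.ofReal p ≤
      T * ENNReal.ofReal (1 - p) + T * ENNReal.ofReal p := by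
    rw [← h4]
    exact (add_le_add_right h1 _).trans h3
  rw [ENNReal.add_le_add_iff_right (ENNReal.mul_ne_top hTtop ENNReal.ofReal_ne_top)] at h5
  calc chordLengths K Φ (Ioo 0 x) ≤ 2 * chordLengths K Φ (Ioo 0 x) :=
        le_mul_of_one_le_left zero_le (by norm_num)
    _ ≤ T * ENNReal.ofReal (1 - p) := h5
    _ ≤ T * ENNReal.ofReal (m / r * x) := by gcongr
    _ = T * ENNReal.ofReal (m / r) * ENNReal.ofReal x := by
      rw [ENNReal.ofReal_mul (by positivity), ← mul_assoc]

theorem lintegral_chordLengths_lt_top (hK : (interior (K : Set (Space (m + 1)))).Nonempty) {q : ℝ}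
    (hq : 0 < q) :
    ∫⁻ x in Ioi 0, ENNReal.ofReal (x ^ (q - 1)) ∂chordLengths K Φ < ∞ := by
  have := isFiniteMeasure_chordLengths Φ hK
  obtain ⟨C, hC, r, hr, h⟩ := exists_chordLengths_Ioo_le Φ hK
  obtain ⟨D, hD0, hD⟩ := exists_radialFunction_le K
  refine lintegral_rpow_lt_top hC hr hq (D := D) ?_ h
  rw [chordLengths_apply K Φ measurableSet_Ioi (Ioi_subset_Ioi hD0.le)]
  suffices h0 : topRadial K Φ ⁻¹' Ioi D = ∅ by rw [h0, measure_empty]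
  refine eq_empty_of_forall_notMem fun p hp => ?_
  by_cases hy : p.1 ∈ shadow K Φ
  · rw [mem_preimage, show p = (p.1, p.2) from rfl, topRadial_of_mem Φ hy] at hp
    exact absurd hp (not_lt.mpr (hD _ (topPoint_mem_of_mem_shadow Φ hy) _))
  · rw [mem_preimage, show p = (p.1, p.2) from rfl, topRadial_of_notMem Φ hy] at hp
    exact absurd hp (not_lt.mpr hD0.le)

end PowerIntegrals

/-! ### Measurability and integration of the dual quermassintegral. -/

section DualQuermassintegral

variable {n : ℕ} (K : ConvexBody (Space n))

/-- The radial function, extended by zero to `z ∉ K`. -/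
def radialOn (p : Space n × Sphere n) : ℝ :=
  open Classical in if p.1 ∈ K then radialFunction K p.1 p.2 else 0

theorem measurable_radialOn : Measurable (radialOn K) := by
  refine measurable_of_Ici fun x => ?_
  rcases le_or_gt x 0 with hx | hx
  · convert MeasurableSet.univ
    refine eq_univ_of_forall fun p => hx.trans ?_
    unfold radialOn
    split_ifs with h
    · exact radialFunction_nonneg h _
    · exact le_rfl
  · have hc : IsClosed {p : Space n × Sphere n |
        p.1 ∈ (K : Set (Space n)) ∧ p.1 + x • (p.2 : Space n) ∈ (K : Set (Space n))} :=
      (K.isClosed.preimage continuous_fst).inter (K.isClosed.preimage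
        (f := fun p : Space n × Sphere n => p.1 + x • (p.2 : Space n)) (by fun_prop))
    convert hc.measurableSet using 1
    ext p
    by_cases h : p.1 ∈ K
    · simp [radialOn, h, le_radialFunction_iff h hx]
    · simp [radialOn, h, hx]

/-- The indicator matters for exponent `0`: `0 ^ 0 = 1` would count chords of length zero. -/
theorem measurable_posRpow (q : ℝ) :
    Measurable ((Ioi (0 : ℝ)).indicator fun x => ENNReal.ofReal (x ^ q)) :=
  Measurable.indicator (by fun_prop) measurableSet_Ioi

variable {K} in
theorem dualQuermassintegral_eq {z : Space n} (hz : z ∈ K) (q : ℝ) :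
    dualQuermassintegral K q z = (n : ℝ≥0∞)⁻¹ * ∫⁻ u, (Ioi (0 : ℝ)).indicator
      (fun x => ENNReal.ofReal (x ^ q)) (radialFunction K z u) ∂sphereMeasure n := by
  have hr : Measurable fun u : Sphere n => radialFunction K z u := by
    have := (measurable_radialOn K).comp (measurable_prodMk_left (x := z))
    convert this using 1
    ext u
    simp [radialOn, hz]
  have hm : MeasurableSet {u : Sphere n | 0 < radialFunction K z u} := hr measurableSet_Ioi
  rw [dualQuermassintegral, ← lintegral_indicator hm]
  rfl

theorem measurable_dualQuermassintegral_subtype (q : ℝ) :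
    Measurable fun z : regularBoundary K => dualQuermassintegral K q z := by
  have h : Measurable fun z : Space n => (n : ℝ≥0∞)⁻¹ * ∫⁻ u, (Ioi (0 : ℝ)).indicator
      (fun x => ENNReal.ofReal (x ^ q)) (radialOn K (z, u)) ∂sphereMeasure n :=
    (((measurable_posRpow q).comp (measurable_radialOn K)).lintegral_prod_right').const_mul _
  convert h.comp measurable_subtype_coe using 1
  ext z
  have hz : (z : Space n) ∈ K := K.isClosed.frontier_subset z.2.1
  simp [dualQuermassintegral_eq hz, radialOn, hz]

/-- Tonelli's theorem, followed by pushing the product measure forward under the chord length. -/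
theorem lintegral_dualQuermassintegral_topPoint {m : ℕ} (K : ConvexBody (Space (m + 1)))
    (Φ : Frame m) (q : ℝ) :
    ∫⁻ y in shadow K Φ, dualQuermassintegral K q (topPoint K Φ y) =
      ((m + 1 : ℕ) : ℝ≥0∞)⁻¹ * ∫⁻ x in Ioi 0, ENNReal.ofReal (x ^ q) ∂chordLengths K Φ := by
  set g : ℝ → ℝ≥0∞ := (Ioi (0 : ℝ)).indicator fun x => ENNReal.ofReal (x ^ q) with hg
  have hgm : Measurable g := measurable_posRpow q
  have hR := measurable_topRadial K Φ
  have h1 : ∀ y, (shadow K Φ).indicator (fun y => dualQuermassintegral K q (topPoint K Φ y)) y =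
      ((m + 1 : ℕ) : ℝ≥0∞)⁻¹ * ∫⁻ u, g (topRadial K Φ (y, u)) ∂sphereMeasure (m + 1) := by
    intro y
    by_cases hy : y ∈ shadow K Φ
    · rw [indicator_of_mem hy, dualQuermassintegral_eq (topPoint_mem_of_mem_shadow Φ hy)]
      simp only [topRadial_of_mem Φ hy, hg]
    · rw [indicator_of_notMem hy]
      simp [topRadial_of_notMem Φ hy, hg]
  have hgR : Measurable fun p => g (topRadial K Φ p) := hgm.comp hR
  rw [← lintegral_indicator (isOpen_shadow K Φ).measurableSet]
  simp_rw [h1]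
  rw [lintegral_const_mul _ hgR.lintegral_prod_right', ← lintegral_prod _ hgR.aemeasurable,
    ← lintegral_map hgm hR, hg, lintegral_indicator measurableSet_Ioi, chordLengths,
    Measure.restrict_restrict measurableSet_Ioi, inter_self]

end DualQuermassintegral

/-! ### Finiteness and centroid of the chord measure. -/

section Centroid

variable {m : ℕ} {K : ConvexBody (Space (m + 1))}

theorem exists_frame {w : Space (m + 1)} (hw : ‖w‖ = 1) : ∃ Φ : Frame m, Φ.w = w := by
  have : Fact (Module.finrank ℝ (Space (m + 1)) = m + 1) := ⟨by simp⟩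
  have hw0 : w ≠ 0 := by
    rintro rfl
    simp at hw
  let b := OrthonormalBasis.fromOrthogonalSpanSingleton (𝕜 := ℝ) m hw0
  refine ⟨⟨(ℝ ∙ w)ᗮ.subtypeₗᵢ.comp b.repr.symm.toLinearIsometry, w, hw, fun y => ?_⟩, rfl⟩
  exact Submodule.mem_orthogonal_singleton_iff_inner_right.mp (b.repr.symm y).2

/-- Since `gaussVec` is `0` off `∂'K`, the condition `f 0 = 0` allows integration over the whole
space. -/
theorem lintegral_chordMeasure (K : ConvexBody (Space (m + 1))) (q : ℝ) {f : Space (m + 1) → ℝ≥0∞}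
    (hf : Measurable f) (h0 : f 0 = 0) :
    ∫⁻ v : Sphere (m + 1), f v ∂chordMeasure K q =
      ENNReal.ofReal (2 * q / unitBallVolume (m + 1)) *
        ∫⁻ z, f (gaussVec K z) * dualQuermassintegral K (q - 1) z ∂μHE[m] := by
  have he : MeasurableEmbedding (Subtype.val : regularBoundary K → Space (m + 1)) :=
    MeasurableEmbedding.subtype_coe (measurableSet_regularBoundary K)
  have hfs : Measurable fun v : Sphere (m + 1) => f v := hf.comp measurable_subtype_coe
  have hfg : Measurable fun z : regularBoundary K => f (gaussMap K z) :=
    hfs.comp (measurable_gaussMap K)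
  rw [chordMeasure, lintegral_smul_measure, smul_eq_mul, lintegral_map hfs (measurable_gaussMap K),
    lintegral_withDensity_eq_lintegral_mul _ (measurable_dualQuermassintegral_subtype K _) hfg]
  congr 1
  have h1 : ∀ z : regularBoundary K, ((fun z : regularBoundary K =>
      dualQuermassintegral K (q - 1) z) * fun z : regularBoundary K => f (gaussMap K z)) z =
      (fun z => f (gaussVec K z) * dualQuermassintegral K (q - 1) z) z.1 := by
    intro z
    simp only [Pi.mul_apply]
    rw [gaussVec_coe, mul_comm]
  rw [lintegral_congr h1, ← he.lintegral_map (fun z => f (gaussVec K z) *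
    dualQuermassintegral K (q - 1) z), he.map_comap, Subtype.range_coe,
    ← lintegral_indicator (measurableSet_regularBoundary K)]
  refine lintegral_congr fun z => ?_
  by_cases hz : z ∈ regularBoundary K
  · rw [indicator_of_mem hz]
  · rw [indicator_of_notMem hz, gaussVec_of_notMem hz, h0, zero_mul]

theorem lintegral_inner_chordMeasure (hK : (interior (K : Set (Space (m + 1)))).Nonempty) (q : ℝ)
    (Φ : Frame m) :
    ∫⁻ v : Sphere (m + 1), ENNReal.ofReal (inner ℝ Φ.w (v : Space (m + 1))) ∂chordMeasure K q =
      ENNReal.ofReal (2 * q / unitBallVolume (m + 1)) * (((m + 1 : ℕ) : ℝ≥0∞)⁻¹ *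
        ∫⁻ x in Ioi 0, ENNReal.ofReal (x ^ (q - 1)) ∂chordLengths K Φ) := by
  rw [lintegral_chordMeasure K q (f := fun v => ENNReal.ofReal (inner ℝ Φ.w v)) (by fun_prop)
    (by simp), lintegral_inner_gaussVec Φ hK, lintegral_dualQuermassintegral_topPoint]

theorem lintegral_inner_chordMeasure_lt_top (hK : (interior (K : Set (Space (m + 1)))).Nonempty)
    {q : ℝ} (hq : 0 < q) {w : Space (m + 1)} (hw : ‖w‖ = 1) :
    ∫⁻ v : Sphere (m + 1), ENNReal.ofReal (inner ℝ w (v : Space (m + 1))) ∂chordMeasure K q < ∞ := by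
  obtain ⟨Φ, rfl⟩ := exists_frame hw
  rw [lintegral_inner_chordMeasure hK]
  exact ENNReal.mul_lt_top ENNReal.ofReal_lt_top (ENNReal.mul_lt_top
    (ENNReal.inv_lt_top.mpr (by positivity)) (lintegral_chordLengths_lt_top Φ hK hq))

/-- Reversing the frame turns `w` into `-w` and leaves the distribution of chord lengths unchanged.
-/
theorem lintegral_inner_neg_chordMeasure (hK : (interior (K : Set (Space (m + 1)))).Nonempty)
    (q : ℝ) {w : Space (m + 1)} (hw : ‖w‖ = 1) :
    ∫⁻ v : Sphere (m + 1), ENNReal.ofReal (-inner ℝ w (v : Space (m + 1))) ∂chordMeasure K q =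
      ∫⁻ v : Sphere (m + 1), ENNReal.ofReal (inner ℝ w (v : Space (m + 1))) ∂chordMeasure K q := by
  obtain ⟨Φ, rfl⟩ := exists_frame hw
  have h := lintegral_inner_chordMeasure hK q Φ.neg
  rw [chordLengths_neg Φ hK, ← lintegral_inner_chordMeasure hK q Φ] at h
  rw [← h]
  refine lintegral_congr fun v => ?_
  rw [show Φ.neg.w = -Φ.w from rfl, inner_neg_left]

/-- On the sphere `1 = ∑ v_i² ≤ ∑ |v_i|`, so the total mass is bounded by the finite integrals for
the vectors `± e i`. -/
theorem isFiniteMeasure_chordMeasure (hK : (interior (K : Set (Space (m + 1)))).Nonempty) {q : ℝ}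
    (hq : 0 < q) : IsFiniteMeasure (chordMeasure K q) := by
  refine ⟨?_⟩
  let e : Fin (m + 1) → Space (m + 1) := fun i => EuclideanSpace.single i 1
  have he : ∀ i, ‖e i‖ = 1 := fun i => by simp [e]
  have hle : ∀ v : Sphere (m + 1), (1 : ℝ≥0∞) ≤
      ∑ i, (ENNReal.ofReal (inner ℝ (e i) (v : Space (m + 1))) +
        ENNReal.ofReal (inner ℝ (-e i) (v : Space (m + 1)))) := by
    intro v
    have hv : ∑ i, (v : Space (m + 1)) i ^ 2 = 1 := by
      rw [← EuclideanSpace.real_norm_sq_eq, mem_sphere_zero_iff_norm.mp v.2, one_pow]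
    have h1 : ∀ i, |(v : Space (m + 1)) i| ≤ 1 := by
      intro i
      have := Finset.single_le_sum (f := fun i => (v : Space (m + 1)) i ^ 2)
        (fun i _ => sq_nonneg _) (Finset.mem_univ i)
      rw [hv] at this
      exact (sq_le_one_iff_abs_le_one _).mp this
    have h2 : (1 : ℝ) ≤ ∑ i, |(v : Space (m + 1)) i| := by
      refine hv.symm.trans_le ?_
      refine Finset.sum_le_sum fun i _ => ?_
      rw [← sq_abs]
      nlinarith [h1 i, abs_nonneg ((v : Space (m + 1)) i)]
    calc (1 : ℝ≥0∞) ≤ ENNReal.ofReal (∑ i, |(v : Space (m + 1)) i|) := by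
          rw [← ENNReal.ofReal_one]
          exact ENNReal.ofReal_le_ofReal h2
      _ = ∑ i, ENNReal.ofReal |(v : Space (m + 1)) i| :=
          ENNReal.ofReal_sum_of_nonneg fun i _ => abs_nonneg _
      _ ≤ _ := by
          refine Finset.sum_le_sum fun i _ => ?_
          have hi : inner ℝ (e i) (v : Space (m + 1)) = (v : Space (m + 1)) i := by
            simp [e, EuclideanSpace.inner_single_left]
          rw [inner_neg_left, hi]
          rcases abs_cases ((v : Space (m + 1)) i) with ⟨h, -⟩ | ⟨h, -⟩
          · rw [h]
            exact le_self_add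
          · rw [h]
            exact le_add_self
  calc chordMeasure K q univ = ∫⁻ _, 1 ∂chordMeasure K q := lintegral_one.symm
    _ ≤ _ := lintegral_mono hle
    _ = ∑ i, (∫⁻ v : Sphere (m + 1), ENNReal.ofReal (inner ℝ (e i) (v : Space (m + 1)))
          ∂chordMeasure K q + ∫⁻ v : Sphere (m + 1),
            ENNReal.ofReal (inner ℝ (-e i) (v : Space (m + 1))) ∂chordMeasure K q) := by
      rw [lintegral_finsetSum _ (fun i _ => by fun_prop)]
      refine Finset.sum_congr rfl fun i _ => lintegral_add_left (by fun_prop) _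
    _ < ∞ := by
      refine ENNReal.sum_lt_top.mpr fun i _ => ENNReal.add_lt_top.mpr ⟨?_, ?_⟩
      · exact lintegral_inner_chordMeasure_lt_top hK hq (he i)
      · exact lintegral_inner_chordMeasure_lt_top hK hq (by rw [norm_neg, he i])

theorem integral_chordMeasure (hK : (interior (K : Set (Space (m + 1)))).Nonempty) {q : ℝ}
    (hq : 0 < q) : ∫ v : Sphere (m + 1), (v : Space (m + 1)) ∂chordMeasure K q = 0 := by
  have := isFiniteMeasure_chordMeasure hK hq
  have hint : Integrable (fun v : Sphere (m + 1) => (v : Space (m + 1))) (chordMeasure K q) :=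
    Integrable.of_bound (by fun_prop) 1
      (Filter.Eventually.of_forall fun v => (mem_sphere_zero_iff_norm.mp v.2).le)
  ext i
  have hw : ‖(EuclideanSpace.single i 1 : Space (m + 1))‖ = 1 := by simp
  have h1 : inner ℝ (EuclideanSpace.single i 1 : Space (m + 1))
      (∫ v : Sphere (m + 1), (v : Space (m + 1)) ∂chordMeasure K q) = (0 : ℝ) := by
    rw [← integral_inner hint, integral_eq_lintegral_pos_part_sub_lintegral_neg_part
      (hint.const_inner _), lintegral_inner_neg_chordMeasure hK q hw, sub_self]
  simpa [EuclideanSpace.inner_single_left] using h1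

end Centroid

end ChordMeasure

end

theorem corollary4p11 (n : ℕ) (hn : 1 ≤ n) (K : ConvexBody (EuclideanSpace ℝ (Fin n)))
    (hK : (interior (K : Set (EuclideanSpace ℝ (Fin n)))).Nonempty) (q : ℝ) (hq : 0 < q) :
    IsFiniteMeasure (ChordMeasure.chordMeasure K q) ∧
      ∫ v : sphere (0 : EuclideanSpace ℝ (Fin n)) 1, (v : EuclideanSpace ℝ (Fin n))
        ∂(ChordMeasure.chordMeasure K q) = 0 := by
  obtain ⟨m, rfl⟩ := Nat.exists_eq_add_of_le' hn
  exact ⟨ChordMeasure.isFiniteMeasure_chordMeasure hK hq, ChordMeasure.integral_chordMeasure hK hq⟩
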